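/- Let $n\ge 0$ and let $S_n$ act on $X=\{0,1\}^n$ by permuting coordinates; let $X_m$ be the set of words of Hamming weight $m$. Let $\mathbb K$ be $\mathbb R$ or $\mathbb C$, and equip $\mathbb K^X$ with the action $(af)(x)=f(a^{-1}x)$ and the inner product $(f,g)=\frac1{2^n}\sum_{x\in X}f(x)\overline{g(x)}$. A $G$-isometry is an equivariant linear isomorphism that preserves the inner product; $S_n$-spaces are equivalent if there is a $G$-isometry between them. There is an orthogonal decomposition $$\mathbb K^X=\bigoplus_{k=0}^{\lfloor n/2\rfloor}\ \bigoplus_{i=k}^{n-k}H_{k,i}$$ into irreducible $S_n$-spaces such that $H_{k,i}$ consists of functions supported on $X_i$ and is equivalent to the Specht module of the partition $(n-k,k)$, and such that $H_{k,i}$ and $H_{k',i'}$ are equivalent if and only if $k=k'$. For every such decomposition, $\dim H_{k,i}=h_k:=\binom nk-\binom n{k-1}$. Fix such a decomposition and $0\le k\le\lfloor n/2\rfloor$. Let $(e_l)_{l}$ be an orthonormal basis of $H_{k,k}$, let $\phi_{i}:H_{k,k}\to H_{k,i}$ ($k\le i\le n-k$) be $G$-isometries, and set $$E_{k,i,j}(x,y)=\frac1{2^n}\sum_{l}\phi_{i}(e_l)(x)\,\overline{\phi_{j}(e_l)(y)}\qquad(x,y\in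 X,\ k\le i,j\le n-k).$$ For $x,y\in X$ put $v(x,y)=|\{l: x_l=1,\ y_l=0\}|$. Write $(a)_k=a(a+1)\cdots(a+k-1)$, $(a)_0=1$, and $$Q_k(x;-a-1,-b-1,m)=\frac1{\binom mk}\sum_{t=0}^k(-1)^t\frac{\binom{b-k+t}{t}}{\binom at}\binom{m-x}{k-t}\binom xt$$ for the Hahn polynomials. For $k\le i\le j\le n-k$, $x\in X_i$, $y\in X_j$ put $$F_{k,i,j}(x,y)=\frac{h_k}{\left(\binom ni\binom nj\right)^{1/2}}\left(\frac{(-j)_k(i-n)_k}{(-i)_k(j-n)_k}\right)^{-1/2}Q_k\bigl(v(x,y);-(n-j)-1,-j-1,i\bigr).$$ (1) For every orthonormal basis $(e_l)$ of $H_{k,k}$, the $G$-isometries $\phi_{i}$ can be chosen, with $\phi_{k}=\mathrm{id}$, such that for all $k\le i\le j\le n-k$ we have $E_{k,i,j}(x,y)=F_{k,i,j}(x,y)$ whenever $x\in X_i$, $y\in X_j$; and such that, for all $k\le i,j\le n-k$, $E_{k,i,j}(x,y)=0$ whenever $x\notin X_i$ or $y\notin X_j$, and $E_{k,j,i}=(E_{k,i,j})^t$.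 (2) For every orthonormal basis $(e_l)$ of $H_{k,k}$ and every choice of the $G$-isometries $\phi_i$ there are scalars $\varepsilon_i\in\mathbb K$ with $|\varepsilon_i|=1$ (signs, if $\mathbb K=\mathbb R$) such that $E_{k,i,j}(x,y)=\varepsilon_i\overline{\varepsilon_j}\,F_{k,i,j}(x,y)$ for all $k\le i\le j\le n-k$, $x\in X_i$, $y\in X_j$. Moreover, for all $k\le i,j\le n-k$, $E_{k,i,j}(x,y)=0$ whenever $x\notin X_i$ or $y\notin X_j$, and $E_{k,j,i}=(\overline{E_{k,i,j}})^t$. -/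

import Mathlib

open scoped BigOperators ComplexConjugate

noncomputable section

namespace Terwilliger

/-! ### Group actions on the function space of a finite set -/

section General

variable {𝕜 X : Type*} [RCLike 𝕜]

/-- The action of a group `G` on functions on a `G`-set: `(a f)(x) = f (a⁻¹ x)`. -/
def translate {G : Type*} [Group G] [MulAction G X] (a : G) (f : X → 𝕜) : X → 𝕜 :=
  fun x => f (a⁻¹ • x)

/-- The normalized inner product `(f, g) = |X|⁻¹ ∑ x, f x * conj (g x)`. -/
def ip [Fintype X] (f g : X → 𝕜) : 𝕜 :=
  (1 / (Fintype.card X : 𝕜)) * ∑ x, f x * conj (g x)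

/-- A `G`-space: a subspace of the function space that is stable under `G`. -/
def IsGSpace (G : Type*) [Group G] [MulAction G X] (H : Submodule 𝕜 (X → 𝕜)) : Prop :=
  ∀ (a : G), ∀ f ∈ H, translate a f ∈ H

/-- An irreducible `G`-space: its only proper `G`-subspace is `0` (so it is itself nonzero). -/
def IsIrreducibleGSpace (G : Type*) [Group G] [MulAction G X]
    (H : Submodule 𝕜 (X → 𝕜)) : Prop :=
  IsGSpace G H ∧ H ≠ ⊥ ∧ ∀ H' : Submodule 𝕜 (X → 𝕜), H' < H → IsGSpace G H' → H' = ⊥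

/-- A `G`-isometry between two `G`-spaces: a linear isomorphism which commutes with the action of
`G` and preserves the inner product. -/
structure GIsometry (G : Type*) [Group G] [MulAction G X] [Fintype X]
    (H H' : Submodule 𝕜 (X → 𝕜)) where
  toEquiv : H ≃ₗ[𝕜] H'
  map_translate : ∀ (a : G) (f : H) (hf : translate a (f : X → 𝕜) ∈ H),
    (toEquiv ⟨translate a (f : X → 𝕜), hf⟩ : X → 𝕜) = translate a (toEquiv f : X → 𝕜)
  map_ip : ∀ f g : H, ip (toEquiv f : X → 𝕜) (toEquiv g : X → 𝕜) = ip (f : X → 𝕜) (g : X → 𝕜)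

/-- Two `G`-spaces are equivalent if there is a `G`-isometry between them. -/
def GEquivalent (G : Type*) [Group G] [MulAction G X] [Fintype X]
    (H H' : Submodule 𝕜 (X → 𝕜)) : Prop :=
  Nonempty (GIsometry G H H')

/-- The finite family `e` is an orthonormal basis of the subspace `H`. -/
def IsOrthonormalBasis [Fintype X] {H : Submodule 𝕜 (X → 𝕜)} {r : ℕ} (e : Fin r → H) : Prop :=
  (∀ l l' : Fin r, ip (e l : X → 𝕜) (e l' : X → 𝕜) = if l = l' then 1 else 0) ∧
    Submodule.span 𝕜 (Set.range e) = ⊤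

/-- The family `H k i` is an orthogonal decomposition of the function space on `X` into irreducible
`G`-spaces, such that `H k i` and `H k' i'` are equivalent if and only if `k = k'`. -/
structure IsIrreducibleDecomposition (G : Type*) [Group G] [MulAction G X] [Fintype X]
    {K : Type*} {I : K → Type*} (H : (k : K) → I k → Submodule 𝕜 (X → 𝕜)) : Prop where
  irreducible : ∀ (k : K) (i : I k), IsIrreducibleGSpace G (H k i)
  orthogonal : ∀ p q : (Σ k : K, I k), p ≠ q →
    ∀ f ∈ H p.1 p.2, ∀ g ∈ H q.1 q.2, ip f g = 0
  iSup_eq_top : (⨆ (k : K) (i : I k), H k i) = ⊤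
  equivalent_iff : ∀ (k k' : K) (i : I k) (i' : I k'), GEquivalent G (H k i) (H k' i') ↔ k = k'

/-- The matrix `E_{i,j}(x,y) = |X|⁻¹ ∑ l, e_{i,l}(x) * conj (e_{j,l}(y))`, where `e_{i,l} = φ (e l)`
and `e_{j,l} = ψ (e l)` are the images of the family `e` under the `G`-isometries `φ`, `ψ`. -/
def blockMatrix {G : Type*} [Group G] [MulAction G X] [Fintype X]
    {H₁ H H' : Submodule 𝕜 (X → 𝕜)} {r : ℕ} (e : Fin r → H₁)
    (φ : GIsometry G H₁ H) (ψ : GIsometry G H₁ H') : Matrix X X 𝕜 :=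
  Matrix.of fun x y => (1 / (Fintype.card X : 𝕜)) *
    ∑ l, (φ.toEquiv (e l) : X → 𝕜) x * conj ((ψ.toEquiv (e l) : X → 𝕜) y)

end General

/-! ### Binary words -/

/-- The set `{0,1}^n` of binary words of length `n` (`true` is `1`, `false` is `0`). -/
abbrev BinWord (n : ℕ) : Type := Fin n → Bool

/-- The symmetric group permutes the coordinates of binary words. The inverse turns this into a
left action; `G`-spaces, `G`-isometries and orbits do not depend on that convention. -/
instance permAction (n : ℕ) : MulAction (Equiv.Perm (Fin n)) (BinWord n) where
  smul σ x := fun l => x (σ⁻¹ l)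
  one_smul _ := rfl
  mul_smul σ τ x := by
    funext l
    change x ((σ * τ)⁻¹ l) = x (τ⁻¹ (σ⁻¹ l))
    rw [mul_inv_rev, Equiv.Perm.mul_apply]

/-- The Hamming weight. -/
def weight {n : ℕ} (x : BinWord n) : ℕ := (Finset.univ.filter fun l => x l = true).card

/-- `v(x,y)`, the number of coordinates `l` with `x_l = 1` and `y_l = 0`. -/
def vdiff {n : ℕ} (x y : BinWord n) : ℕ :=
  (Finset.univ.filter fun l => x l = true ∧ y l = false).card

/-! ### The irreducible representation of the symmetric group given by `(n-k, k)` -/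

/-- The boxes of the Young diagram of shape `(n-k, k)` are numbered by `Fin n`, the `n-k` boxes
of the first row coming first. This is the column of the box with number `p`. -/
def boxColumn (n k : ℕ) (p : Fin n) : ℕ := if (p : ℕ) < n - k then p else p - (n - k)

/-- A bijection `t` from the boxes to `{1, …, n}` is a Young tableau of shape `(n-k, k)`. Its
tabloid (the tableau up to row permutations) is given by the set of entries of the second row,
that is, by a binary word of weight `k`. -/
def tabloid {n : ℕ} (k : ℕ) (t : Equiv.Perm (Fin n)) : BinWord n :=
  fun l => decide (n - k ≤ (t⁻¹ l : Fin n))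

/-- The column stabilizer of the tableau `t` of shape `(n-k, k)`. -/
def columnStabilizer {n : ℕ} (k : ℕ) (t : Equiv.Perm (Fin n)) : Finset (Equiv.Perm (Fin n)) :=
  Finset.univ.filter fun σ => ∀ l, boxColumn n k (t⁻¹ (σ l)) = boxColumn n k (t⁻¹ l)

/-- The polytabloid of the tableau `t`: the signed sum of the translates of its tabloid under the
column stabilizer. -/
def polytabloid (𝕜 : Type*) [RCLike 𝕜] {n : ℕ} (k : ℕ) (t : Equiv.Perm (Fin n)) :
    BinWord n → 𝕜 :=
  ∑ σ ∈ columnStabilizer k t,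
    ((Equiv.Perm.sign σ : ℤ) : 𝕜) • (Pi.single (σ • tabloid k t) (1 : 𝕜) : BinWord n → 𝕜)

/-- The Specht module of the partition `(n-k, k)`, inside the functions on binary words. -/
def specht (𝕜 : Type*) [RCLike 𝕜] (n k : ℕ) : Submodule 𝕜 (BinWord n → 𝕜) :=
  Submodule.span 𝕜 (Set.range fun t : Equiv.Perm (Fin n) => polytabloid 𝕜 k t)

/-! ### The decomposition of the function space on binary words -/

/-- The index `k` runs over `0, …, ⌊n/2⌋`. -/
abbrev TypeIdx (n : ℕ) : Type := Fin (n / 2 + 1)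

/-- For given `k`, the indices `i`, `j` run over `k, …, n-k`. -/
abbrev RowIdx (n : ℕ) (k : TypeIdx n) : Type := {i : ℕ // (k : ℕ) ≤ i ∧ i ≤ n - (k : ℕ)}

/-- The first row index, `k` itself. -/
def firstRow {n : ℕ} (k : TypeIdx n) : RowIdx n k :=
  ⟨k, le_rfl, by have := k.isLt; omega⟩

/-- `H k i`, for `k = 0, …, ⌊n/2⌋` and `i = k, …, n-k`, is an orthogonal decomposition of the
function space on `{0,1}^n` into irreducible `S_n`-spaces, equivalent exactly when they have the
same `k`, where `H k i` consists of functions supported on the words of weight `i` and affords the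
irreducible representation given by the partition `(n-k, k)`. -/
structure IsBinaryDecomposition {𝕜 : Type*} [RCLike 𝕜] {n : ℕ}
    (H : (k : TypeIdx n) → RowIdx n k → Submodule 𝕜 (BinWord n → 𝕜)) : Prop
    extends IsIrreducibleDecomposition (Equiv.Perm (Fin n)) H where
  supported : ∀ (k : TypeIdx n) (i : RowIdx n k), ∀ f ∈ H k i, ∀ x, weight x ≠ (i : ℕ) → f x = 0
  partition_type : ∀ (k : TypeIdx n) (i : RowIdx n k),
    GEquivalent (Equiv.Perm (Fin n)) (H k i) (specht 𝕜 n k)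

/-! ### Hahn polynomials and the normalizing constant -/

/-- The dimension `h_k = binom n k - binom n (k-1)`, where `binom n (-1) = 0`. -/
def hdim (n k : ℕ) : ℝ := (n.choose k : ℝ) - if k = 0 then 0 else (n.choose (k - 1) : ℝ)

/-- The value at `x` of the Hahn polynomial `Q_k(x; -a-1, -b-1, m)`, for
`k ≤ a`, `k ≤ b`, `k ≤ m` and `x ≤ m` (then no subtraction below is truncated, and no denominator
vanishes). -/
def hahnQ (k x a b m : ℕ) : ℝ :=
  (1 / (m.choose k : ℝ)) * ∑ t ∈ Finset.range (k + 1),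
    (-1 : ℝ) ^ t * (((b - k + t).choose t : ℝ) / (a.choose t : ℝ)) *
      ((m - x).choose (k - t) : ℝ) * (x.choose t : ℝ)

/-- The Pochhammer symbol `(a)_k = a (a+1) ⋯ (a+k-1)`. -/
def poch (a : ℝ) (k : ℕ) : ℝ := (ascPochhammer ℝ k).eval a

/-- The number
`h_k / (binom n i * binom n j)^(1/2) * ((-j)_k (i-n)_k / ((-i)_k (j-n)_k))^(-1/2)`. -/
def normConst (n k i j : ℕ) : ℝ :=
  hdim n k / Real.sqrt ((n.choose i : ℝ) * (n.choose j : ℝ)) *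
    ((poch (-(j : ℝ)) k * poch ((i : ℝ) - n) k) /
      (poch (-(i : ℝ)) k * poch ((j : ℝ) - n) k)) ^ (-(1 / 2) : ℝ)

end Terwilliger

end

/-! Everything is computed in one model of the type (n-k,k): the space `harmonic 𝕜 n k`. The key
fact is a rigidity, `sum_vdiff_eq`: for harmonic f and any word x, the sum of f over the words at
difference v from x is (-1)^v C(k,v) times the sum of f below x. So pairing f with any function of
`vdiff y x` yields a multiple of `subsetSum` (`sum_mul_vdiff`).

Averaging over the stabilizer of x turns this into Schur's lemma (`exists_eq_mul_subsetSum`): an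
equivariant map out of a space of harmonic functions is, on the words of weight i, a scalar times
`levelSum`. This works over ℝ and ℂ alike. The same averaging shows that every nonzero invariant
subspace contains the columns of an explicit reproducing kernel, so the harmonic space is
irreducible. It therefore equals the Specht module, since polytabloids are harmonic, and the trace
of the kernel gives the dimension h_k.

By `sum_subsetSum_mul_conj`, `levelSum` multiplies inner products of harmonic functions by
`levelNorm`, and its images for distinct k are orthogonal. A dimension count shows that these images
fill the function space. Conversely, support and type force every admissible H_{k,i} to be such an
image (`eq_levelSpace`).

Hence φ_i is `levelSum` times `levelFactor` times a unimodular ε_i, and E_{k,i,j}(x,y) is, up to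
these factors, the kernel summed over the words x' below x and y' below y. The sum over y' is
harmonic in x' and depends only on `vdiff x' y`, so its values are known up to one constant.
Counting the x' below x by that difference produces the Hahn polynomial; choosing every ε_i = 1
gives the exact formula. -/

noncomputable section

namespace Terwilliger

/-! ### Binomial identities. -/

section Counting

/-- The number of `m`-subsets of `s` with exactly `t` elements outside `u`. -/
theorem card_powersetCard_filter_sdiff {α : Type*} [DecidableEq α] (s u : Finset α) {m t : ℕ}
    (ht : t ≤ m) :
    ((s.powersetCard m).filter fun z => (z \ u).card = t).card =
      (s \ u).card.choose t * (s ∩ u).card.choose (m - t) := by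
  rw [← Finset.card_powersetCard, ← Finset.card_powersetCard, ← Finset.card_product]
  refine Finset.card_nbij' (fun z => (z \ u, z ∩ u)) (fun p => p.1 ∪ p.2) ?_ ?_ ?_ ?_
  · intro z hz
    simp only [Finset.coe_filter, Finset.mem_powersetCard, Set.mem_ofPred_eq] at hz
    simp only [Finset.coe_product, Set.mem_prod, Finset.mem_coe, Finset.mem_powersetCard]
    have := Finset.card_sdiff_add_card_inter z u
    exact ⟨⟨Finset.sdiff_subset_sdiff hz.1.1 subset_rfl, hz.2⟩,
      Finset.inter_subset_inter hz.1.1 subset_rfl, by omega⟩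
  · rintro ⟨a, b⟩ hp
    simp only [Finset.coe_product, Set.mem_prod, Finset.mem_coe, Finset.mem_powersetCard] at hp
    simp only [Finset.coe_filter, Finset.mem_powersetCard, Set.mem_ofPred_eq]
    obtain ⟨⟨ha, ha'⟩, hb, hb'⟩ := hp
    have hd : Disjoint a b := Finset.disjoint_left.2 fun l hl hl' =>
      (Finset.mem_sdiff.1 (ha hl)).2 (Finset.mem_inter.1 (hb hl')).2
    have h1 : (a ∪ b) \ u = a := by
      ext l
      have := @ha l
      have := @hb l
      simp only [Finset.mem_sdiff, Finset.mem_inter, Finset.mem_union] at *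
      tauto
    refine ⟨⟨Finset.union_subset (ha.trans Finset.sdiff_subset)
      (hb.trans Finset.inter_subset_left), ?_⟩, by rw [h1, ha']⟩
    rw [Finset.card_union_of_disjoint hd]
    omega
  · intro z _
    exact Finset.sdiff_union_inter z u
  · rintro ⟨a, b⟩ hp
    simp only [Finset.coe_product, Set.mem_prod, Finset.mem_coe, Finset.mem_powersetCard] at hp
    obtain ⟨⟨ha, -⟩, hb, -⟩ := hp
    ext l
    all_goals
      have := @ha l
      have := @hb l
      simp only [Finset.mem_sdiff, Finset.mem_inter, Finset.mem_union] at *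
      tauto

/-- The `k`-th difference of a binomial coefficient. -/
theorem sum_neg_one_pow_choose_mul_choose (k : ℕ) : ∀ M r : ℕ, k ≤ M → k ≤ r →
    ∑ t ∈ Finset.range (k + 1), (-1 : ℝ) ^ t * (k.choose t : ℝ) * ((M - t).choose r : ℝ) =
      ((M - k).choose (r - k) : ℝ) := by
  induction k with
  | zero => intro M r _ _; simp
  | succ k ih =>
    intro M r hM hr
    obtain ⟨M, rfl⟩ : ∃ M', M = M' + 1 := ⟨M - 1, by omega⟩
    have h1 := ih (M + 1) r (by omega) (by omega)
    have h2 := ih M r (by omega) (by omega)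
    -- Pascal's rule for C(k+1,t) makes the new sum the difference of the old sums at M+1 and at M.
    have key : ∑ t ∈ Finset.range (k + 1 + 1),
        (-1 : ℝ) ^ t * ((k + 1).choose t : ℝ) * ((M + 1 - t).choose r : ℝ) =
        ∑ t ∈ Finset.range (k + 1), (-1 : ℝ) ^ t * (k.choose t : ℝ) * ((M + 1 - t).choose r : ℝ) -
        ∑ t ∈ Finset.range (k + 1), (-1 : ℝ) ^ t * (k.choose t : ℝ) * ((M - t).choose r : ℝ) := by
      -- The added term t = k+1 is zero because C(k,k+1) = 0; it aligns the ranges.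
      have e1 : ∑ t ∈ Finset.range (k + 1),
          (-1 : ℝ) ^ t * (k.choose t : ℝ) * ((M + 1 - t).choose r : ℝ) =
          ∑ t ∈ Finset.range (k + 1 + 1),
          (-1 : ℝ) ^ t * (k.choose t : ℝ) * ((M + 1 - t).choose r : ℝ) := by
        rw [Finset.sum_range_succ _ (k + 1)]
        simp
      rw [e1, Finset.sum_range_succ' _ (k + 1), Finset.sum_range_succ' _ (k + 1), add_sub_right_comm,
        ← Finset.sum_sub_distrib]
      congr 1
      · refine Finset.sum_congr rfl fun t _ => ?_
        rw [Nat.choose_succ_succ, show M + 1 - (t + 1) = M - t by omega]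
        push_cast
        ring
      · simp
    rw [key, h1, h2]
    obtain ⟨a, ha⟩ : ∃ a, M = k + a := ⟨M - k, by omega⟩
    obtain ⟨b, hb⟩ : ∃ b, r = k + 1 + b := ⟨r - (k + 1), by omega⟩
    rw [show M + 1 - k = a + 1 by omega, show r - k = b + 1 by omega, show M - k = a by omega,
      show M + 1 - (k + 1) = a by omega, show r - (k + 1) = b by omega, Nat.choose_succ_succ]
    push_cast
    ring

end Counting

/-! ### Binary words as sets: orbits of pairs and counting. -/

section Words

variable {n : ℕ}

/-- The set of coordinates where a binary word is `1`. -/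
def supp (x : BinWord n) : Finset (Fin n) := Finset.univ.filter fun l => x l = true

@[simp] theorem mem_supp {x : BinWord n} {l : Fin n} : l ∈ supp x ↔ x l = true := by simp [supp]

/-- Binary words correspond to sets of coordinates. -/
def suppEquiv (n : ℕ) : BinWord n ≃ Finset (Fin n) where
  toFun := supp
  invFun s := fun l => decide (l ∈ s)
  left_inv x := by funext l; simp
  right_inv s := by ext l; simp

@[simp] theorem suppEquiv_apply (x : BinWord n) : suppEquiv n x = supp x := rfl

@[simp] theorem supp_suppEquiv_symm (s : Finset (Fin n)) : supp ((suppEquiv n).symm s) = s :=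
  (suppEquiv n).apply_symm_apply s

theorem supp_injective : Function.Injective (supp : BinWord n → Finset (Fin n)) :=
  (suppEquiv n).injective

theorem weight_eq (x : BinWord n) : weight x = (supp x).card := rfl

theorem vdiff_eq (x y : BinWord n) : vdiff x y = (supp x \ supp y).card := by
  unfold vdiff
  congr 1
  ext l
  simp

theorem weight_le (x : BinWord n) : weight x ≤ n := by
  simpa [weight_eq] using Finset.card_le_univ (supp x)

theorem vdiff_le_weight (x y : BinWord n) : vdiff x y ≤ weight x := by
  rw [vdiff_eq, weight_eq]
  exact Finset.card_le_card Finset.sdiff_subset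

theorem vdiff_eq_zero {x y : BinWord n} : vdiff x y = 0 ↔ supp x ⊆ supp y := by
  rw [vdiff_eq, Finset.card_eq_zero, Finset.sdiff_eq_empty_iff_subset]

theorem vdiff_add_card_inter (x y : BinWord n) :
    vdiff x y + (supp x ∩ supp y).card = weight x := by
  rw [vdiff_eq, weight_eq, Finset.card_sdiff_add_card_inter]

theorem weight_add_vdiff (x y : BinWord n) :
    weight x + vdiff y x = weight y + vdiff x y := by
  have h1 := vdiff_add_card_inter x y
  have h2 := vdiff_add_card_inter y x
  rw [Finset.inter_comm] at h2
  omega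

theorem vdiff_comm_of_weight_eq {x y : BinWord n} (h : weight x = weight y) :
    vdiff x y = vdiff y x := by
  have := weight_add_vdiff x y
  omega

theorem smul_word_apply (σ : Equiv.Perm (Fin n)) (x : BinWord n) (l : Fin n) :
    (σ • x) l = x (σ⁻¹ l) := rfl

theorem supp_smul (σ : Equiv.Perm (Fin n)) (x : BinWord n) :
    supp (σ • x) = (supp x).map σ.toEmbedding := by
  ext l
  rw [mem_supp, smul_word_apply, Finset.mem_map_equiv, mem_supp]
  rfl

@[simp] theorem weight_smul (σ : Equiv.Perm (Fin n)) (x : BinWord n) :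
    weight (σ • x) = weight x := by
  rw [weight_eq, supp_smul, Finset.card_map, weight_eq]

@[simp] theorem vdiff_smul (σ : Equiv.Perm (Fin n)) (x y : BinWord n) :
    vdiff (σ • x) (σ • y) = vdiff x y := by
  rw [vdiff_eq, supp_smul, supp_smul, vdiff_eq]
  rw [Finset.map_eq_image, Finset.map_eq_image,
    ← Finset.image_sdiff _ _ σ.toEmbedding.injective, Finset.card_image_of_injective]
  exact σ.toEmbedding.injective

@[simp] theorem supp_smul_subset_supp_smul (σ : Equiv.Perm (Fin n)) {x y : BinWord n} :
    supp (σ • x) ⊆ supp (σ • y) ↔ supp x ⊆ supp y := by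
  rw [supp_smul, supp_smul, Finset.map_subset_map]

/-- Pairs of words are in the same orbit when their weights and differences agree. -/
theorem exists_smul_eq {x y x' y' : BinWord n} (hx : weight x = weight x')
    (hy : weight y = weight y') (hv : vdiff x y = vdiff x' y') :
    ∃ σ : Equiv.Perm (Fin n), σ • x = x' ∧ σ • y = y' := by
  have hv2 : vdiff y x = vdiff y' x' := by
    have := weight_add_vdiff x y
    have := weight_add_vdiff x' y'
    omega
  have hu : (supp x ∪ supp y).card = (supp x' ∪ supp y').card := by
    have h1 := Finset.card_union_add_card_inter (supp x) (supp y)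
    have h2 := Finset.card_union_add_card_inter (supp x') (supp y')
    have h3 := vdiff_add_card_inter x y
    have h4 := vdiff_add_card_inter x' y'
    simp only [weight_eq] at *
    omega
  have hi : (supp x ∩ supp y).card = (supp x' ∩ supp y').card := by
    have h3 := vdiff_add_card_inter x y
    have h4 := vdiff_add_card_inter x' y'
    omega
  -- The two weights and the difference determine the sizes of all four classes of coordinates with
  -- given (x_l, y_l); bijections between corresponding classes glue to σ.
  have hcard : ∀ c : Bool × Bool, Fintype.card {l // (x l, y l) = c} =
      Fintype.card {l // (x' l, y' l) = c} := by
    intro c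
    rw [Fintype.card_subtype, Fintype.card_subtype]
    obtain ⟨a, b⟩ := c
    cases a <;> cases b
    · have e : ∀ x y : BinWord n, (Finset.univ.filter fun l => (x l, y l) = (false, false)) =
          (supp x ∪ supp y)ᶜ := by
        intro x y; ext l; simp
      rw [e, e, Finset.card_compl, Finset.card_compl, hu]
    · have e : ∀ x y : BinWord n, (Finset.univ.filter fun l => (x l, y l) = (false, true)) =
          supp y \ supp x := by
        intro x y; ext l; simp [and_comm]
      rw [e, e, ← vdiff_eq, ← vdiff_eq, hv2]
    · have e : ∀ x y : BinWord n, (Finset.univ.filter fun l => (x l, y l) = (true, false)) =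
          supp x \ supp y := by
        intro x y; ext l; simp
      rw [e, e, ← vdiff_eq, ← vdiff_eq, hv]
    · have e : ∀ x y : BinWord n, (Finset.univ.filter fun l => (x l, y l) = (true, true)) =
          supp x ∩ supp y := by
        intro x y; ext l; simp
      rw [e, e, hi]
  let σ : Equiv.Perm (Fin n) := Equiv.ofFiberEquiv (f := fun l => (x l, y l))
    (g := fun l => (x' l, y' l)) fun c => Fintype.equivOfCardEq (hcard c)
  have hσ : ∀ l, (x' (σ l), y' (σ l)) = (x l, y l) := fun l =>
    Equiv.ofFiberEquiv_map (f := fun l => (x l, y l)) (g := fun l => (x' l, y' l)) _ l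
  refine ⟨σ, ?_, ?_⟩
  · funext l
    have := (Prod.ext_iff.1 (hσ (σ⁻¹ l))).1
    rw [show σ (σ⁻¹ l) = l from σ.apply_symm_apply l] at this
    exact this.symm
  · funext l
    have := (Prod.ext_iff.1 (hσ (σ⁻¹ l))).2
    rw [show σ (σ⁻¹ l) = l from σ.apply_symm_apply l] at this
    exact this.symm

theorem exists_smul_eq_of_weight_eq {x y : BinWord n} (h : weight x = weight y) :
    ∃ σ : Equiv.Perm (Fin n), σ • x = y := by
  obtain ⟨σ, h1, -⟩ := exists_smul_eq h h (by simp [vdiff_eq])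
  exact ⟨σ, h1⟩

theorem card_filter_word (p : Finset (Fin n) → Prop) [DecidablePred p] :
    (Finset.univ.filter fun x : BinWord n => p (supp x)).card = (Finset.univ.filter p).card := by
  refine Finset.card_equiv (suppEquiv n) fun x => ?_
  simp

/-- The number of words of weight `m` below `y` with difference `t` from `x`. -/
theorem card_filter_weight_vdiff_subset (x y : BinWord n) {m t : ℕ} (ht : t ≤ m) :
    (Finset.univ.filter fun z : BinWord n =>
      weight z = m ∧ vdiff z x = t ∧ supp z ⊆ supp y).card =
      (vdiff y x).choose t * (weight y - vdiff y x).choose (m - t) := by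
  have h := card_powersetCard_filter_sdiff (supp y) (supp x) ht
  have h2 := vdiff_add_card_inter y x
  rw [show weight y - vdiff y x = (supp y ∩ supp x).card by omega, vdiff_eq, ← h]
  have := card_filter_word (n := n) (fun s => s.card = m ∧ (s \ supp x).card = t ∧ s ⊆ supp y)
  simp only [weight_eq, vdiff_eq]
  rw [this]
  congr 1
  ext s
  simp only [Finset.mem_filter, Finset.mem_univ, true_and, Finset.mem_powersetCard]
  tauto

/-- The number of words of weight `m` with difference `t` from `x`. -/
theorem card_filter_weight_vdiff (x : BinWord n) {m t : ℕ} (ht : t ≤ m) :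
    (Finset.univ.filter fun z : BinWord n => weight z = m ∧ vdiff z x = t).card =
      (n - weight x).choose t * (weight x).choose (m - t) := by
  -- Apply the count below y to the all-ones word, where being below is no restriction.
  have h := card_filter_weight_vdiff_subset x ((suppEquiv n).symm Finset.univ) ht
  simp only [supp_suppEquiv_symm, Finset.subset_univ, and_true, vdiff_eq, weight_eq] at h ⊢
  rw [h, Finset.card_sdiff_of_subset (Finset.subset_univ _), Finset.card_univ, Fintype.card_fin]
  have := weight_le x
  rw [weight_eq] at this
  rw [Nat.sub_sub_self this]

theorem card_filter_weight (m : ℕ) :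
    (Finset.univ.filter fun z : BinWord n => weight z = m).card = n.choose m := by
  have := card_filter_word (n := n) (fun s => s.card = m)
  refine this.trans ?_
  rw [← Finset.powerset_univ, ← Finset.powersetCard_eq_filter, Finset.card_powersetCard,
    Finset.card_univ, Fintype.card_fin]

/-- The number of words of weight `j` above a given set of coordinates. -/
theorem card_filter_weight_superset (u : Finset (Fin n)) {j : ℕ} (hj : j ≤ n) :
    (Finset.univ.filter fun z : BinWord n => weight z = j ∧ u ⊆ supp z).card =
      (n - u.card).choose (n - j) := by
  have := card_filter_word (n := n) (fun s => s.card = j ∧ u ⊆ s)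
  refine this.trans ?_
  have h : (uᶜ.powersetCard (n - j)).card = (n - u.card).choose (n - j) := by
    rw [Finset.card_powersetCard, Finset.card_compl, Fintype.card_fin]
  rw [← h]
  -- Complements of the supersets are subsets of `uᶜ`. The resulting lower index n-j is independent
  -- of u, as the difference identity `sum_neg_one_pow_choose_mul_choose` requires.
  refine Finset.card_nbij' compl compl ?_ ?_ ?_ ?_
  · intro s hs
    simp only [Finset.coe_filter, Finset.mem_univ, true_and, Set.mem_ofPred_eq] at hs
    simp only [Finset.mem_coe, Finset.mem_powersetCard, Finset.compl_subset_compl,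
      Finset.card_compl, Fintype.card_fin]
    exact ⟨hs.2, by rw [hs.1]⟩
  · intro s hs
    simp only [Finset.mem_coe, Finset.mem_powersetCard] at hs
    simp only [Finset.coe_filter, Finset.mem_univ, true_and, Set.mem_ofPred_eq,
      Finset.card_compl, Fintype.card_fin]
    exact ⟨by omega, Finset.subset_compl_comm.1 hs.1⟩
  · intro s _; exact compl_compl s
  · intro s _; exact compl_compl s

end Words

/-! ### Harmonic functions, their rigidity, and Schur's lemma. -/

section Harmonic

variable {𝕜 : Type*} [RCLike 𝕜] {n : ℕ}

/-- The sum of a function over all words below a given one. -/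
def subsetSum (𝕜 : Type*) [RCLike 𝕜] (n : ℕ) : (BinWord n → 𝕜) →ₗ[𝕜] (BinWord n → 𝕜) where
  toFun f x := ∑ y with supp y ⊆ supp x, f y
  map_add' f g := by funext x; simp [Finset.sum_add_distrib]
  map_smul' c f := by funext x; simp [Finset.mul_sum]

theorem subsetSum_apply (f : BinWord n → 𝕜) (x : BinWord n) :
    subsetSum 𝕜 n f x = ∑ y with supp y ⊆ supp x, f y := rfl

/-- The restriction of `subsetSum` to the words of weight `i`. -/
def levelSum (𝕜 : Type*) [RCLike 𝕜] (n i : ℕ) : (BinWord n → 𝕜) →ₗ[𝕜] (BinWord n → 𝕜) where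
  toFun f x := if weight x = i then subsetSum 𝕜 n f x else 0
  map_add' f g := by funext x; by_cases h : weight x = i <;> simp [h]
  map_smul' c f := by funext x; by_cases h : weight x = i <;> simp [h]

theorem levelSum_apply (i : ℕ) (f : BinWord n → 𝕜) (x : BinWord n) :
    levelSum 𝕜 n i f x = if weight x = i then subsetSum 𝕜 n f x else 0 := rfl

/-- The functions supported on the words of weight `k` whose sum over the words above any word of
weight `k - 1` vanishes. -/
def harmonic (𝕜 : Type*) [RCLike 𝕜] (n k : ℕ) : Submodule 𝕜 (BinWord n → 𝕜) where
  carrier := {f | (∀ x, weight x ≠ k → f x = 0) ∧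
    ∀ z : BinWord n, weight z + 1 = k → ∑ y with supp z ⊆ supp y, f y = 0}
  add_mem' := by
    rintro f g ⟨hf, hf'⟩ ⟨hg, hg'⟩
    refine ⟨fun x hx => by simp [hf x hx, hg x hx], fun z hz => ?_⟩
    simp [Finset.sum_add_distrib, hf' z hz, hg' z hz]
  zero_mem' := by simp
  smul_mem' := by
    rintro c f ⟨hf, hf'⟩
    refine ⟨fun x hx => by simp [hf x hx], fun z hz => ?_⟩
    simp [← Finset.mul_sum, hf' z hz]

theorem translate_apply {𝕜 : Type*} (σ : Equiv.Perm (Fin n)) (f : BinWord n → 𝕜) (x : BinWord n) :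
    translate σ f x = f (σ⁻¹ • x) := rfl

theorem sum_filter_smul (σ : Equiv.Perm (Fin n)) (p q : BinWord n → Prop) [DecidablePred p]
    [DecidablePred q] (hpq : ∀ y, p (σ • y) ↔ q y) (f : BinWord n → 𝕜) :
    ∑ y with p y, f y = ∑ y with q y, f (σ • y) := by
  rw [Finset.sum_filter, Finset.sum_filter, ← Equiv.sum_comp (MulAction.toPerm σ)]
  simp [hpq]

theorem sum_smul_word (σ : Equiv.Perm (Fin n)) (f : BinWord n → 𝕜) :
    ∑ y, f (σ • y) = ∑ y, f y :=
  Equiv.sum_comp (MulAction.toPerm σ) f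

theorem subsetSum_translate (σ : Equiv.Perm (Fin n)) (f : BinWord n → 𝕜) :
    subsetSum 𝕜 n (translate σ f) = translate σ (subsetSum 𝕜 n f) := by
  funext x
  rw [subsetSum_apply, translate_apply, subsetSum_apply]
  rw [sum_filter_smul σ _ (fun y => supp y ⊆ supp (σ⁻¹ • x))]
  · simp [translate_apply]
  · intro y
    rw [← supp_smul_subset_supp_smul σ (x := y), smul_inv_smul]

theorem levelSum_translate (i : ℕ) (σ : Equiv.Perm (Fin n)) (f : BinWord n → 𝕜) :
    levelSum 𝕜 n i (translate σ f) = translate σ (levelSum 𝕜 n i f) := by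
  funext x
  rw [levelSum_apply, subsetSum_translate, translate_apply, translate_apply, levelSum_apply,
    weight_smul]

theorem isGSpace_harmonic (k : ℕ) :
    IsGSpace (Equiv.Perm (Fin n)) (harmonic 𝕜 n k) := by
  rintro σ f ⟨hf, hf'⟩
  refine ⟨fun x hx => hf _ (by simpa using hx), fun z hz => ?_⟩
  rw [sum_filter_smul σ _ (fun y => supp (σ⁻¹ • z) ⊆ supp y)]
  · simpa [translate_apply] using hf' (σ⁻¹ • z) (by simpa using hz)
  · intro y
    rw [← supp_smul_subset_supp_smul σ (y := y), smul_inv_smul]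

theorem subsetSum_of_weight_eq {k : ℕ} {f : BinWord n → 𝕜} (hf : ∀ x, weight x ≠ k → f x = 0)
    {x : BinWord n} (hx : weight x = k) : subsetSum 𝕜 n f x = f x := by
  rw [subsetSum_apply, Finset.sum_eq_single x]
  · intro y hy hyx
    refine hf y fun hk => hyx (supp_injective ?_)
    exact Finset.eq_of_subset_of_card_le (by simpa using hy)
      (by rw [← weight_eq, ← weight_eq, hk, hx])
  · simp

theorem subsetSum_of_weight_lt {k : ℕ} {f : BinWord n → 𝕜} (hf : ∀ x, weight x ≠ k → f x = 0)
    {x : BinWord n} (hx : weight x < k) : subsetSum 𝕜 n f x = 0 := by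
  rw [subsetSum_apply]
  refine Finset.sum_eq_zero fun y hy => hf y ?_
  have := Finset.card_le_card (Finset.mem_filter.1 hy).2
  rw [← weight_eq, ← weight_eq] at this
  omega

theorem levelSum_self {k : ℕ} {f : BinWord n → 𝕜} (hf : f ∈ harmonic 𝕜 n k) :
    levelSum 𝕜 n k f = f := by
  funext x
  rw [levelSum_apply]
  split_ifs with h
  · exact subsetSum_of_weight_eq hf.1 h
  · exact (hf.1 x h).symm

/-- Add the harmonic relations of all z of weight k-1 at difference v from x, and count each y of
weight k. If y has difference v+1, such a z arises by deleting one of its v+1 ones outside x; if y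
has difference v, by deleting one of its k-v ones inside x; other y lie above no such z. -/
theorem sum_vdiff_recursion {k : ℕ} {f : BinWord n → 𝕜} (hf : f ∈ harmonic 𝕜 n k)
    (x : BinWord n) {v : ℕ} (hv : v < k) :
    ((v + 1 : ℕ) : 𝕜) * ∑ y with vdiff y x = v + 1, f y +
      ((k - v : ℕ) : 𝕜) * ∑ y with vdiff y x = v, f y = 0 := by
  have h0 : ∑ z : BinWord n with weight z = k - 1 ∧ vdiff z x = v,
      ∑ y with supp z ⊆ supp y, f y = 0 := by
    refine Finset.sum_eq_zero fun z hz => hf.2 z ?_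
    have := (Finset.mem_filter.1 hz).2.1
    omega
  rw [← h0]
  simp_rw [Finset.sum_filter, Finset.mul_sum]
  rw [← Finset.sum_filter, Finset.sum_comm, ← Finset.sum_add_distrib]
  refine Finset.sum_congr rfl fun y _ => ?_
  by_cases hy : weight y = k
  swap
  · simp [hf.1 y hy]
  rw [← Finset.sum_filter, Finset.filter_filter, Finset.sum_const, nsmul_eq_mul]
  have hc := card_filter_weight_vdiff_subset x y (m := k - 1) (t := v) (by omega)
  simp only [and_assoc]
  rw [hc, hy]
  have hle := vdiff_le_weight y x
  rw [hy] at hle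
  by_cases h1 : vdiff y x = v + 1
  · rw [if_pos h1, if_neg (by omega), h1, show k - (v + 1) = k - 1 - v by omega]
    simp
  · rw [if_neg h1]
    by_cases h2 : vdiff y x = v
    · rw [if_pos h2, h2, show k - v = k - 1 - v + 1 by omega]
      simp
    · rw [if_neg h2]
      rcases Nat.lt_or_ge (vdiff y x) v with h3 | h3
      · simp [Nat.choose_eq_zero_of_lt h3]
      · rw [Nat.choose_eq_zero_of_lt (show k - vdiff y x < k - 1 - v by omega)]
        simp

/-- Iterate the recursion from v = 0, where the sum is `subsetSum`, using (v+1) C(k,v+1) = (k-v)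
C(k,v). -/
theorem sum_vdiff_eq {k : ℕ} {f : BinWord n → 𝕜} (hf : f ∈ harmonic 𝕜 n k)
    (x : BinWord n) {v : ℕ} (hv : v ≤ k) :
    ∑ y with vdiff y x = v, f y = (-1) ^ v * (k.choose v : 𝕜) * subsetSum 𝕜 n f x := by
  induction v with
  | zero => simp [subsetSum_apply, vdiff_eq_zero]
  | succ v ih =>
    have h := sum_vdiff_recursion hf x (v := v) (by omega)
    rw [ih (by omega)] at h
    have h2 := Nat.choose_succ_right_eq k v
    have h3 : (k.choose (v + 1) : 𝕜) * ((v + 1 : ℕ) : 𝕜) = (k.choose v : 𝕜) * ((k - v : ℕ) : 𝕜) := by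
      exact_mod_cast h2
    have h4 : ((v + 1 : ℕ) : 𝕜) ≠ 0 := Nat.cast_ne_zero.2 (by omega)
    refine mul_left_cancel₀ h4 ?_
    rw [eq_neg_of_add_eq_zero_left h]
    rw [show ((v + 1 : ℕ) : 𝕜) * ((-1) ^ (v + 1) * (k.choose (v + 1) : 𝕜) * subsetSum 𝕜 n f x) =
      (-1) ^ (v + 1) * ((k.choose (v + 1) : 𝕜) * ((v + 1 : ℕ) : 𝕜)) * subsetSum 𝕜 n f x by ring, h3]
    ring

/-- A weighted sum of a harmonic function, with weights that depend only on the difference from a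
word `x`, is a multiple of the sum below `x`. -/
theorem sum_mul_vdiff {k : ℕ} {f : BinWord n → 𝕜} (hf : f ∈ harmonic 𝕜 n k)
    (x : BinWord n) (c : ℕ → 𝕜) :
    ∑ y, c (vdiff y x) * f y =
      (∑ t ∈ Finset.range (k + 1), c t * ((-1) ^ t * (k.choose t : 𝕜))) * subsetSum 𝕜 n f x := by
  have h1 : ∑ y, c (vdiff y x) * f y =
      ∑ y, ∑ t ∈ Finset.range (k + 1), if vdiff y x = t then c t * f y else 0 := by
    refine Finset.sum_congr rfl fun y _ => ?_
    rw [Finset.sum_ite_eq]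
    split_ifs with h
    · rfl
    · rw [hf.1 y, mul_zero]
      have := vdiff_le_weight y x
      simp only [Finset.mem_range] at h
      omega
  rw [h1, Finset.sum_comm, Finset.sum_mul]
  refine Finset.sum_congr rfl fun t ht => ?_
  rw [← Finset.sum_filter, ← Finset.mul_sum, sum_vdiff_eq hf x (by simpa using ht)]
  ring

/-- A function with an invariance property depends on differences only. -/
theorem exists_vdiff_function {α : Type*} [Nonempty α] {k j : ℕ} (F : BinWord n → BinWord n → α)
    (hF : ∀ (σ : Equiv.Perm (Fin n)) (x y), F (σ • x) (σ • y) = F x y) :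
    ∃ q : ℕ → α, ∀ x y, weight x = k → weight y = j → F x y = q (vdiff x y) := by
  classical
  -- For each difference that occurs, evaluate F at a chosen pair; the value at other v is
  -- irrelevant.
  refine ⟨fun v => if h : ∃ p : BinWord n × BinWord n, weight p.1 = k ∧ weight p.2 = j ∧
    vdiff p.1 p.2 = v then F h.choose.1 h.choose.2 else Classical.arbitrary α, fun x y hx hy => ?_⟩
  have h : ∃ p : BinWord n × BinWord n, weight p.1 = k ∧ weight p.2 = j ∧
    vdiff p.1 p.2 = vdiff x y := ⟨(x, y), hx, hy, rfl⟩
  simp only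
  rw [dif_pos h]
  obtain ⟨σ, h1, h2⟩ := exists_smul_eq (h.choose_spec.1.trans hx.symm)
    (h.choose_spec.2.1.trans hy.symm) h.choose_spec.2.2
  rw [← hF σ h.choose.1 h.choose.2, h1, h2]

/-- A function that is invariant under the stabilizer of a word depends on differences only. -/
theorem exists_vdiff_function_of_stabilizer {α : Type*} [Nonempty α] {k : ℕ} (x : BinWord n)
    (F : BinWord n → α)
    (hF : ∀ σ : Equiv.Perm (Fin n), σ • x = x → ∀ y, F (σ • y) = F y) :
    ∃ q : ℕ → α, ∀ y, weight y = k → F y = q (vdiff y x) := by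
  classical
  refine ⟨fun v => if h : ∃ y : BinWord n, weight y = k ∧
    vdiff y x = v then F h.choose else Classical.arbitrary α, fun y hy => ?_⟩
  have h : ∃ y' : BinWord n, weight y' = k ∧ vdiff y' x = vdiff y x := ⟨y, hy, rfl⟩
  simp only
  rw [dif_pos h]
  obtain ⟨σ, h1, h2⟩ := exists_smul_eq (h.choose_spec.1.trans hy.symm) rfl h.choose_spec.2
  rw [← hF σ h2 h.choose, h1]

/-- **Schur's lemma** for spaces of harmonic functions: an equivariant map is, on each level, a
multiple of `levelSum`. -/
theorem exists_eq_mul_subsetSum {k : ℕ} {H : Submodule 𝕜 (BinWord n → 𝕜)}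
    (hH : H ≤ harmonic 𝕜 n k) (hG : IsGSpace (Equiv.Perm (Fin n)) H)
    (A : H →ₗ[𝕜] (BinWord n → 𝕜))
    (hA : ∀ (σ : Equiv.Perm (Fin n)) (f : H),
      A ⟨translate σ (f : BinWord n → 𝕜), hG σ f f.2⟩ = translate σ (A f)) (i : ℕ) :
    ∃ c : 𝕜, ∀ (f : H) (x : BinWord n), weight x = i → A f x = c * subsetSum 𝕜 n f x := by
  classical
  by_cases hi : ∃ x : BinWord n, weight x = i
  swap
  · exact ⟨0, fun f x hx => (hi ⟨x, hx⟩).elim⟩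
  obtain ⟨x, hx⟩ := hi
  -- One word of weight i is enough: equivariance carries the same c along its orbit, which is all
  -- of that weight.
  suffices h : ∃ c : 𝕜, ∀ f : H, A f x = c * subsetSum 𝕜 n f x by
    obtain ⟨c, hc⟩ := h
    refine ⟨c, fun f y hy => ?_⟩
    obtain ⟨σ, rfl⟩ := exists_smul_eq_of_weight_eq (hx.trans hy.symm)
    have := hc ⟨translate σ⁻¹ (f : BinWord n → 𝕜), hG σ⁻¹ f f.2⟩
    rw [hA, subsetSum_translate] at this
    simpa [translate_apply] using this
  -- Extending f ↦ A f x to all functions gives coefficients at point masses. They need not be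
  -- invariant, but averaging them over the stabilizer of x leaves the values on H unchanged, since
  -- A is equivariant.
  obtain ⟨ℓ, hℓ⟩ := LinearMap.exists_extend ((LinearMap.proj x : (BinWord n → 𝕜) →ₗ[𝕜] 𝕜) ∘ₗ A)
  have hℓ' : ∀ f : H, ℓ f = A f x := fun f => LinearMap.congr_fun hℓ f
  set S : Finset (Equiv.Perm (Fin n)) := Finset.univ.filter fun σ => σ • x = x with hS
  have hS0 : (S.card : 𝕜) ≠ 0 := by
    rw [Nat.cast_ne_zero, ← Nat.pos_iff_ne_zero, Finset.card_pos]
    exact ⟨1, by simp [hS]⟩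
  let F : BinWord n → 𝕜 := fun y => (S.card : 𝕜)⁻¹ * ∑ σ ∈ S, ℓ (Pi.single (σ • y) 1)
  have hF : ∀ τ : Equiv.Perm (Fin n), τ • x = x → ∀ y, F (τ • y) = F y := by
    intro τ hτ y
    simp only [F]
    congr 1
    refine Finset.sum_nbij' (fun σ => σ * τ) (fun σ => σ * τ⁻¹) ?_ ?_ ?_ ?_ ?_
    · intro σ hσ
      simp only [hS, Finset.mem_filter, Finset.mem_univ, true_and] at hσ ⊢
      rw [mul_smul, hτ, hσ]
    · intro σ hσ
      simp only [hS, Finset.mem_filter, Finset.mem_univ, true_and] at hσ ⊢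
      rw [mul_smul, inv_smul_eq_iff.2 hτ.symm, hσ]
    · intro σ _; simp
    · intro σ _; simp
    · intro σ _; rw [mul_smul]
  obtain ⟨q, hq⟩ := exists_vdiff_function_of_stabilizer (k := k) x F hF
  refine ⟨∑ t ∈ Finset.range (k + 1), q t * ((-1) ^ t * (k.choose t : 𝕜)), fun f => ?_⟩
  rw [← sum_mul_vdiff (hH f.2) x q]
  have hsum : ∀ g : BinWord n → 𝕜, ℓ g = ∑ y, g y * ℓ (Pi.single y 1) := by
    intro g
    conv_lhs => rw [pi_eq_sum_univ' g]
    simp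
  have h1 : ∀ σ ∈ S, A f x = ∑ y, (f : BinWord n → 𝕜) y * ℓ (Pi.single (σ • y) 1) := by
    intro σ hσ
    simp only [hS, Finset.mem_filter, Finset.mem_univ, true_and] at hσ
    have h2 := hℓ' ⟨translate σ (f : BinWord n → 𝕜), hG σ f f.2⟩
    rw [hA, translate_apply, inv_smul_eq_iff.2 hσ.symm] at h2
    rw [← h2, hsum, ← sum_smul_word σ]
    simp [translate_apply]
  have h3 : A f x = (S.card : 𝕜)⁻¹ * ∑ σ ∈ S, A f x := by
    rw [Finset.sum_const, nsmul_eq_mul, inv_mul_cancel_left₀ hS0]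
  rw [h3, Finset.sum_congr rfl h1, Finset.sum_comm, Finset.mul_sum]
  refine Finset.sum_congr rfl fun y _ => ?_
  by_cases hy : weight y = k
  · rw [← hq y hy, ← Finset.mul_sum]
    simp only [F]
    ring
  · rw [(hH f.2).1 y hy]
    simp

/-- The inner products of the level sums of harmonic functions. -/
theorem sum_subsetSum_mul_conj {k k' i : ℕ} (hi : i ≤ n) (hk : k ≤ n - k') (hki : k ≤ n - i)
    {f g : BinWord n → 𝕜} (hf : f ∈ harmonic 𝕜 n k) (hg : ∀ x, weight x ≠ k' → g x = 0) :
    ∑ x with weight x = i, subsetSum 𝕜 n f x * conj (subsetSum 𝕜 n g x) =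
      ((n - k' - k).choose (n - i - k) : 𝕜) * ∑ y, subsetSum 𝕜 n f y * conj (g y) := by
  -- Exchange sums: the words of weight i above both y and y' number C(n-k'-v, n-i), with v = `vdiff
  -- y y'`. For fixed y' this is a weight to which `sum_mul_vdiff` applies, and the resulting
  -- coefficient is a k-th difference.
  have h1 : ∑ x with weight x = i, subsetSum 𝕜 n f x * conj (subsetSum 𝕜 n g x) =
      ∑ y', conj (g y') * ∑ y, ((n - k' - vdiff y y').choose (n - i) : 𝕜) * f y := by
    simp only [subsetSum_apply, map_sum, Finset.sum_mul_sum]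
    have e : ∀ y' y : BinWord n, conj (g y') *
        (((n - k' - vdiff y y').choose (n - i) : 𝕜) * f y) =
        ∑ x with weight x = i, if supp y ⊆ supp x ∧ supp y' ⊆ supp x then f y * conj (g y') else 0 := by
      intro y' y
      by_cases hy' : weight y' = k'
      swap
      · simp [hg y' hy']
      rw [← Finset.sum_filter, Finset.filter_filter, Finset.sum_const, nsmul_eq_mul]
      have hc := card_filter_weight_superset (supp y' ∪ supp y) hi
      have hu : (supp y' ∪ supp y).card = k' + vdiff y y' := by
        rw [vdiff_eq, ← hy', weight_eq, ← Finset.card_union_of_disjoint Finset.disjoint_sdiff,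
          Finset.union_sdiff_self_eq_union]
      rw [hu, ← Nat.sub_sub] at hc
      have hset : (Finset.univ.filter fun x : BinWord n =>
          weight x = i ∧ supp y ⊆ supp x ∧ supp y' ⊆ supp x) =
          Finset.univ.filter fun x : BinWord n => weight x = i ∧ supp y' ∪ supp y ⊆ supp x := by
        ext x
        simp only [Finset.mem_filter, Finset.mem_univ, true_and, Finset.union_subset_iff]
        tauto
      rw [hset, hc]
      ring
    simp_rw [Finset.mul_sum, e]
    symm
    rw [Finset.sum_congr rfl fun y' _ => Finset.sum_comm]
    rw [Finset.sum_comm]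
    refine Finset.sum_congr rfl fun x _ => ?_
    rw [Finset.sum_comm, Finset.sum_filter]
    refine Finset.sum_congr rfl fun y _ => ?_
    by_cases h : supp y ⊆ supp x
    · simp only [h, true_and, if_true, Finset.sum_filter]
    · simp [h]
  rw [h1, Finset.mul_sum]
  refine Finset.sum_congr rfl fun y' _ => ?_
  rw [sum_mul_vdiff hf y' fun t => ((n - k' - t).choose (n - i) : 𝕜)]
  have := sum_neg_one_pow_choose_mul_choose k (n - k') (n - i) hk hki
  have h2 : ∑ t ∈ Finset.range (k + 1),
      ((n - k' - t).choose (n - i) : 𝕜) * ((-1) ^ t * (k.choose t : 𝕜)) =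
      ((n - k' - k).choose (n - i - k) : 𝕜) := by
    have h3 := congrArg (RCLike.ofReal : ℝ → 𝕜) this
    push_cast at h3
    rw [← h3]
    exact Finset.sum_congr rfl fun t _ => by ring
  rw [h2]
  ring

end Harmonic

/-! ### The reproducing kernel and irreducibility. -/

section Kernel

variable {𝕜 : Type*} [RCLike 𝕜] {n : ℕ}

/-- Since C(k,t)/C(N,t) = C(N-t,k-t)/C(N,k), the sum is a hockey-stick sum. -/
theorem sum_choose_div_choose {k N : ℕ} (hk : k ≤ N) :
    ∑ t ∈ Finset.range (k + 1), (k.choose t : ℝ) / (N.choose t : ℝ) * ((N : ℝ) + 1 - k) = N + 1 := by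
  have h1 : ∀ m k : ℕ, ∑ t ∈ Finset.range (k + 1), (m + t).choose t = (m + k + 1).choose k := by
    intro m k
    induction k with
    | zero => simp
    | succ k ih =>
      rw [Finset.sum_range_succ, ih, show m + (k + 1) + 1 = m + k + 1 + 1 by ring,
        Nat.choose_succ_succ, show m + (k + 1) = m + k + 1 by ring]
  have hN : (N.choose k : ℝ) ≠ 0 := Nat.cast_ne_zero.2 (Nat.choose_pos hk).ne'
  have h2 : ∀ t ∈ Finset.range (k + 1), (k.choose t : ℝ) / (N.choose t : ℝ) =
      ((N - t).choose (k - t) : ℝ) / (N.choose k : ℝ) := by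
    intro t ht
    have ht' : t ≤ k := by simpa [Nat.lt_succ_iff] using ht
    have h3 := Nat.choose_mul (n := N) ht'
    have h4 : (N.choose t : ℝ) ≠ 0 := Nat.cast_ne_zero.2 (Nat.choose_pos (ht'.trans hk)).ne'
    rw [div_eq_div_iff h4 hN]
    have h5 : (N.choose k : ℝ) * (k.choose t : ℝ) = (N.choose t : ℝ) * ((N - t).choose (k - t) : ℝ) := by
      exact_mod_cast h3
    linarith
  have h6 : ∑ t ∈ Finset.range (k + 1), (N - t).choose (k - t) = (N + 1).choose k := by
    rw [← Finset.sum_range_reflect, ← show N - k + k + 1 = N + 1 by omega, ← h1 (N - k) k]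
    refine Finset.sum_congr rfl fun t ht => ?_
    have ht' : t ≤ k := by simpa [Nat.lt_succ_iff] using ht
    congr 1 <;> omega
  have h7 := Nat.choose_mul_succ_eq N k
  have h8 : (N.choose k : ℝ) * ((N : ℝ) + 1) = ((N + 1).choose k : ℝ) * ((N : ℝ) + 1 - k) := by
    have h9 : ((N + 1 - k : ℕ) : ℝ) = (N : ℝ) + 1 - k := by
      rw [Nat.cast_sub (by omega)]; push_cast; ring
    rw [← h9]
    exact_mod_cast h7
  rw [← Finset.sum_mul, Finset.sum_congr rfl h2, ← Finset.sum_div, ← Nat.cast_sum, h6,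
    div_mul_eq_mul_div, ← h8]
  field_simp

theorem hdim_mul_eq {k : ℕ} (hk : k ≤ n - k) (hn : k ≤ n) :
    hdim n k * ((n : ℝ) - k + 1) = (n.choose k : ℝ) * ((n : ℝ) - k + 1 - k) := by
  unfold hdim
  rcases k with _ | k
  · simp
  · have h := Nat.choose_succ_right_eq n k
    have h9 : ((n - k : ℕ) : ℝ) = (n : ℝ) - k := by rw [Nat.cast_sub (by omega)]
    have h' : (n.choose (k + 1) : ℝ) * ((k : ℝ) + 1) = (n.choose k : ℝ) * ((n : ℝ) - k) := by
      rw [← h9]; exact_mod_cast h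
    simp only [Nat.add_eq_zero_iff, one_ne_zero, and_false, if_false, Nat.add_sub_cancel]
    push_cast
    linear_combination h'

/-- This fixes the constant h_k / C(n,k) in the kernel: it is exactly what makes the kernel
reproducing. -/
theorem hdim_mul_sum {k : ℕ} (hk : k ≤ n - k) (hn : k ≤ n) :
    hdim n k / (n.choose k : ℝ) *
      ∑ t ∈ Finset.range (k + 1), (k.choose t : ℝ) / ((n - k).choose t : ℝ) = 1 := by
  have h1 := sum_choose_div_choose hk
  have h2 := hdim_mul_eq hk hn
  rw [← Finset.sum_mul, Nat.cast_sub hn] at h1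
  have h3 : (n.choose k : ℝ) ≠ 0 := Nat.cast_ne_zero.2 (Nat.choose_pos hn).ne'
  have h4 : (2 * k : ℝ) ≤ n := by exact_mod_cast (by omega : 2 * k ≤ n)
  have h5 : (0 : ℝ) < (n : ℝ) - k + 1 - k := by linarith
  have h6 : (0 : ℝ) < (n : ℝ) - k + 1 := by linarith [(Nat.cast_nonneg k : (0 : ℝ) ≤ k)]
  rw [div_mul_eq_mul_div, div_eq_one_iff_eq h3]
  set s := ∑ t ∈ Finset.range (k + 1), (k.choose t : ℝ) / ((n - k).choose t : ℝ)
  refine mul_right_cancel₀ (mul_pos h5 h6).ne' ?_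
  calc hdim n k * s * (((n : ℝ) - k + 1 - k) * ((n : ℝ) - k + 1))
      = (hdim n k * ((n : ℝ) - k + 1)) * (s * ((n : ℝ) - k + 1 - k)) := by ring
    _ = _ := by rw [h1, h2]; ring

theorem hdim_pos {k : ℕ} (hk : k ≤ n - k) (hn : k ≤ n) : 0 < hdim n k := by
  have h2 := hdim_mul_eq hk hn
  have h3 : (0 : ℝ) < n.choose k := Nat.cast_pos.2 (Nat.choose_pos hn)
  have h4 : (2 * k : ℝ) ≤ n := by exact_mod_cast (by omega : 2 * k ≤ n)
  have h5 : (0 : ℝ) < (n : ℝ) - k + 1 - k := by linarith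
  have h6 : (0 : ℝ) < (n : ℝ) - k + 1 := by linarith [(Nat.cast_nonneg k : (0 : ℝ) ≤ k)]
  refine pos_of_mul_pos_left ?_ h6.le
  rw [h2]
  positivity

/-- The reproducing kernel of the space of harmonic functions. -/
def harmonicKernel (𝕜 : Type*) [RCLike 𝕜] (n k : ℕ) (x y : BinWord n) : 𝕜 :=
  if weight x = k ∧ weight y = k then
    ((hdim n k / (n.choose k : ℝ) * ((-1) ^ vdiff x y / ((n - k).choose (vdiff x y) : ℝ)) : ℝ) : 𝕜)
  else 0

theorem harmonicKernel_smul (k : ℕ) (σ : Equiv.Perm (Fin n)) (x y : BinWord n) :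
    harmonicKernel 𝕜 n k (σ • x) (σ • y) = harmonicKernel 𝕜 n k x y := by
  simp [harmonicKernel]

theorem harmonicKernel_comm (k : ℕ) (x y : BinWord n) :
    harmonicKernel 𝕜 n k x y = harmonicKernel 𝕜 n k y x := by
  unfold harmonicKernel
  by_cases h : weight x = k ∧ weight y = k
  · rw [if_pos h, if_pos h.symm, vdiff_comm_of_weight_eq (h.1.trans h.2.symm)]
  · rw [if_neg h, if_neg fun h' => h h'.symm]

theorem conj_harmonicKernel (k : ℕ) (x y : BinWord n) :
    conj (harmonicKernel 𝕜 n k x y) = harmonicKernel 𝕜 n k x y := by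
  unfold harmonicKernel
  split_ifs
  · exact RCLike.conj_ofReal _
  · simp

theorem harmonicKernel_self {k : ℕ} {x : BinWord n} (hx : weight x = k) :
    harmonicKernel 𝕜 n k x x = ((hdim n k / (n.choose k : ℝ) : ℝ) : 𝕜) := by
  simp [harmonicKernel, hx, vdiff_eq]

/-- A row of the kernel depends on the difference only, so `sum_mul_vdiff` evaluates the sum; the
two signs (-1)^t cancel and `hdim_mul_sum` remains. Harmonicity of the kernel itself is not needed
here. -/
theorem sum_harmonicKernel_mul {k : ℕ} (hk : k ≤ n - k) {g : BinWord n → 𝕜}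
    (hg : g ∈ harmonic 𝕜 n k) (x : BinWord n) :
    ∑ y, harmonicKernel 𝕜 n k x y * g y = g x := by
  by_cases hx : weight x = k
  swap
  · rw [hg.1 x hx]
    exact Finset.sum_eq_zero fun y _ => by simp [harmonicKernel, hx]
  have hn : k ≤ n := hx ▸ weight_le x
  let c : ℕ → 𝕜 := fun t =>
    ((hdim n k / (n.choose k : ℝ) * ((-1) ^ t / ((n - k).choose t : ℝ)) : ℝ) : 𝕜)
  have h1 : ∑ y, harmonicKernel 𝕜 n k x y * g y = ∑ y, c (vdiff y x) * g y := by
    refine Finset.sum_congr rfl fun y _ => ?_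
    by_cases hy : weight y = k
    · rw [harmonicKernel_comm, harmonicKernel, if_pos ⟨hy, hx⟩]
    · rw [hg.1 y hy, mul_zero, mul_zero]
  have h2 : ∑ t ∈ Finset.range (k + 1), c t * ((-1) ^ t * (k.choose t : 𝕜)) = 1 := by
    have h3 := congrArg (RCLike.ofReal : ℝ → 𝕜) (hdim_mul_sum hk hn)
    rw [Finset.mul_sum] at h3
    push_cast at h3
    refine Eq.trans (Finset.sum_congr rfl fun t _ => ?_) h3
    simp only [c]
    push_cast
    have : (-1 : 𝕜) ^ t * (-1) ^ t = 1 := by rw [← mul_pow]; simp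
    linear_combination ((hdim n k : 𝕜) / (n.choose k : 𝕜) / ((n - k).choose t : 𝕜) *
      (k.choose t : 𝕜)) * this
  rw [h1, sum_mul_vdiff hg x c, h2, one_mul, subsetSum_of_weight_eq hg.1 hx]

/-- The values of a harmonic function that depends only on the difference from a word `y`. -/
theorem mul_choose_eq_of_harmonic {k j : ℕ} (hkj : k ≤ j) {g : BinWord n → 𝕜}
    (hg : g ∈ harmonic 𝕜 n k) {y : BinWord n} (hy : weight y = j) {q : ℕ → 𝕜}
    (hq : ∀ x, weight x = k → g x = q (vdiff x y)) {v : ℕ} (hv : v ≤ k) :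
    q v * ((n - j).choose v : 𝕜) = (-1) ^ v * ((j - k + v).choose v : 𝕜) * q 0 := by
  -- The class at difference v has C(n-j,v) C(j,k-v) words, on which g is constant; compare with the
  -- rigidity formula for its sum. The case v = 0 eliminates `subsetSum`.
  have h1 : ∀ v ≤ k, q v * (((n - j).choose v : 𝕜) * (j.choose (k - v) : 𝕜)) =
      (-1) ^ v * (k.choose v : 𝕜) * subsetSum 𝕜 n g y := by
    intro v hv
    rw [← sum_vdiff_eq hg y hv]
    have hc := card_filter_weight_vdiff y hv
    rw [hy] at hc
    rw [← Nat.cast_mul, ← hc, mul_comm, ← nsmul_eq_mul, ← Finset.sum_const, Finset.sum_filter,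
      Finset.sum_filter]
    refine Finset.sum_congr rfl fun x _ => ?_
    by_cases hx : weight x = k
    · by_cases hxv : vdiff x y = v
      · simp [hx, hxv, hq x hx]
      · simp [hxv]
    · simp [hx, hg.1 x hx]
  have h0 := h1 0 (Nat.zero_le _)
  simp only [Nat.choose_zero_right, Nat.cast_one, one_mul, Nat.sub_zero, pow_zero] at h0
  have h2 := h1 v hv
  rw [← h0] at h2
  have h3 := Nat.choose_mul (n := j) (Nat.sub_le k v)
  rw [Nat.choose_symm hv, show j - (k - v) = j - k + v by omega, Nat.sub_sub_self hv] at h3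
  have h3' : (j.choose k : 𝕜) * (k.choose v : 𝕜) =
      (j.choose (k - v) : 𝕜) * ((j - k + v).choose v : 𝕜) := by exact_mod_cast h3
  have h4 : (j.choose (k - v) : 𝕜) ≠ 0 :=
    Nat.cast_ne_zero.2 (Nat.choose_pos (by omega)).ne'
  refine mul_right_cancel₀ h4 ?_
  linear_combination h2 + (-1) ^ v * q 0 * h3'

/-- Move a nonzero element of H so that it does not vanish at y, then sum its translates over the
stabilizer of y. The result lies in H, is nonzero at y and depends only on the difference from y, so
harmonicity makes it a multiple of the kernel column. -/
theorem harmonicKernel_mem_of_isGSpace {k : ℕ} (hk : k ≤ n - k)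
    {H : Submodule 𝕜 (BinWord n → 𝕜)} (hH : H ≤ harmonic 𝕜 n k)
    (hG : IsGSpace (Equiv.Perm (Fin n)) H) (h0 : H ≠ ⊥) (y : BinWord n) :
    (fun x => harmonicKernel 𝕜 n k x y) ∈ H := by
  by_cases hy : weight y = k
  swap
  · have : (fun x => harmonicKernel 𝕜 n k x y) = 0 := by funext x; simp [harmonicKernel, hy]
    rw [this]
    exact H.zero_mem
  obtain ⟨f, hf, hf0⟩ := Submodule.exists_mem_ne_zero_of_ne_bot h0
  obtain ⟨w, hw⟩ := Function.ne_iff.1 hf0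
  have hwk : weight w = k := by
    by_contra h
    exact hw ((hH hf).1 w h)
  obtain ⟨τ, rfl⟩ := exists_smul_eq_of_weight_eq (hwk.trans hy.symm)
  set S : Finset (Equiv.Perm (Fin n)) := Finset.univ.filter fun σ => σ • (τ • w) = τ • w with hS
  let F : BinWord n → 𝕜 := ∑ σ ∈ S, translate σ (translate τ f)
  have hFH : F ∈ H := H.sum_mem fun σ _ => hG σ _ (hG τ f hf)
  have hFa : ∀ x, F x = ∑ σ ∈ S, translate τ f (σ⁻¹ • x) := fun x => by
    simp [F, Finset.sum_apply, translate_apply]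
  have hF : ∀ ρ : Equiv.Perm (Fin n), ρ • (τ • w) = τ • w → ∀ x, F (ρ • x) = F x := by
    intro ρ hρ x
    rw [hFa, hFa]
    refine Finset.sum_nbij' (fun σ => ρ⁻¹ * σ) (fun σ => ρ * σ) ?_ ?_ ?_ ?_ ?_
    · intro σ hσ
      simp only [hS, Finset.mem_filter, Finset.mem_univ, true_and] at hσ ⊢
      rw [mul_smul, hσ, inv_smul_eq_iff.2 hρ.symm]
    · intro σ hσ
      simp only [hS, Finset.mem_filter, Finset.mem_univ, true_and] at hσ ⊢
      rw [mul_smul, hσ, hρ]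
    · intro σ _; simp
    · intro σ _; simp
    · intro σ _; rw [mul_inv_rev, inv_inv, mul_smul]
  have hFy : F (τ • w) ≠ 0 := by
    rw [hFa, Finset.sum_congr rfl fun σ hσ => by
      rw [inv_smul_eq_iff.2 (Finset.mem_filter.1 hσ).2.symm, translate_apply, inv_smul_smul],
      Finset.sum_const, nsmul_eq_mul]
    refine mul_ne_zero (Nat.cast_ne_zero.2 (Finset.card_pos.2 ⟨1, by simp [hS]⟩).ne') hw
  obtain ⟨q, hq⟩ := exists_vdiff_function_of_stabilizer (k := k) (τ • w) F hF
  have hq0 : F (τ • w) = q 0 := by rw [hq _ hy]; simp [vdiff_eq]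
  -- With j = k this reads q(v) C(n-k,v) = (-1)^v q(0), the profile of the kernel.
  have hu := fun v hv => mul_choose_eq_of_harmonic le_rfl (hH hFH) hy hq (v := v) hv
  have hE : (fun x => harmonicKernel 𝕜 n k x (τ • w)) =
      (((hdim n k / (n.choose k : ℝ) : ℝ) : 𝕜) * (q 0)⁻¹) • F := by
    funext x
    simp only [harmonicKernel, Pi.smul_apply, smul_eq_mul]
    by_cases hx : weight x = k
    swap
    · simp [hx, (hH hFH).1 x hx]
    have hv := vdiff_le_weight x (τ • w)
    rw [hx] at hv
    have h1 := hu _ hv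
    have h2 : ((n - k).choose (vdiff x (τ • w)) : 𝕜) ≠ 0 :=
      Nat.cast_ne_zero.2 (Nat.choose_pos (by omega)).ne'
    rw [if_pos ⟨hx, hy⟩, hq x hx]
    rw [hq0] at hFy
    simp only [Nat.sub_self, Nat.zero_add, Nat.choose_self, Nat.cast_one, mul_one] at h1
    rw [← eq_div_iff h2] at h1
    rw [h1]
    push_cast
    field_simp
  rw [hE]
  exact H.smul_mem _ hFH

/-- The space of harmonic functions has no proper nonzero `S_n`-subspace. -/
theorem eq_harmonic_of_isGSpace {k : ℕ} (hk : k ≤ n - k)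
    {H : Submodule 𝕜 (BinWord n → 𝕜)} (hH : H ≤ harmonic 𝕜 n k)
    (hG : IsGSpace (Equiv.Perm (Fin n)) H) (h0 : H ≠ ⊥) : H = harmonic 𝕜 n k := by
  refine le_antisymm hH fun g hg => ?_
  have : g = ∑ y, g y • fun x => harmonicKernel 𝕜 n k x y := by
    funext x
    rw [← sum_harmonicKernel_mul hk hg x]
    simp [mul_comm]
  rw [this]
  exact H.sum_mem fun y _ => H.smul_mem _ (harmonicKernel_mem_of_isGSpace hk hH hG h0 y)

end Kernel

/-! ### Specht modules as harmonic functions; their dimension. -/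

section Specht

variable {𝕜 : Type*} [RCLike 𝕜] {n : ℕ}

theorem polytabloid_apply (k : ℕ) (t : Equiv.Perm (Fin n)) (x : BinWord n) :
    polytabloid 𝕜 k t x = ∑ σ ∈ columnStabilizer k t,
      if σ • tabloid k t = x then ((Equiv.Perm.sign σ : ℤ) : 𝕜) else 0 := by
  rw [polytabloid, Finset.sum_apply]
  refine Finset.sum_congr rfl fun σ _ => ?_
  rw [Pi.smul_apply, Pi.single_apply, smul_eq_mul]
  by_cases h : σ • tabloid k t = x
  · simp [h]
  · simp [h, Ne.symm h]

theorem weight_tabloid {k : ℕ} (hk : k ≤ n) (t : Equiv.Perm (Fin n)) :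
    weight (tabloid k t) = k := by
  have h : tabloid k t = t • tabloid k 1 := by
    funext l
    simp [tabloid, smul_word_apply]
  rw [h, weight_smul]
  have h2 : weight (tabloid k (1 : Equiv.Perm (Fin n))) =
      (Finset.univ.filter fun l : Fin n => n - k ≤ (l : ℕ)).card := by
    simp [weight, tabloid]
  have h3 := Finset.card_filter_add_card_filter_not (s := Finset.univ)
    fun l : Fin n => (l : ℕ) < n - k
  simp only [not_lt, Finset.card_univ, Fintype.card_fin, Fin.card_filter_val_lt] at h3
  omega

theorem mem_columnStabilizer {k : ℕ} {t σ : Equiv.Perm (Fin n)} :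
    σ ∈ columnStabilizer k t ↔ ∀ l, boxColumn n k (t⁻¹ (σ l)) = boxColumn n k (t⁻¹ l) := by
  simp [columnStabilizer]

theorem mul_mem_columnStabilizer {k : ℕ} {t σ τ : Equiv.Perm (Fin n)}
    (hσ : σ ∈ columnStabilizer k t) (hτ : τ ∈ columnStabilizer k t) :
    σ * τ ∈ columnStabilizer k t := by
  rw [mem_columnStabilizer] at *
  intro l
  rw [Equiv.Perm.mul_apply, hσ, hτ]

/-- A word z of weight k-1 misses both entries of one of the k columns of length two. Swapping these
entries fixes z and lies in the column stabilizer, so it pairs off the terms above z with opposite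
signs. -/
theorem polytabloid_mem_harmonic {k : ℕ} (hk : k ≤ n - k) (hn : k ≤ n) (t : Equiv.Perm (Fin n)) :
    polytabloid 𝕜 k t ∈ harmonic 𝕜 n k := by
  refine ⟨fun x hx => ?_, fun z hz => ?_⟩
  · rw [polytabloid_apply]
    refine Finset.sum_eq_zero fun σ _ => if_neg fun h => hx ?_
    rw [← h, weight_smul, weight_tabloid hn]
  · have h1 : ∑ y with supp z ⊆ supp y, polytabloid 𝕜 k t y =
        ∑ σ ∈ columnStabilizer k t,
          if supp z ⊆ supp (σ • tabloid k t) then ((Equiv.Perm.sign σ : ℤ) : 𝕜) else 0 := by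
      simp_rw [polytabloid_apply]
      rw [Finset.sum_comm]
      refine Finset.sum_congr rfl fun σ _ => ?_
      rw [Finset.sum_ite_eq]
      simp
    rw [h1]
    have hcard : ((supp z).image fun l => boxColumn n k (t⁻¹ l : Fin n)).card <
        (Finset.range k).card := by
      rw [Finset.card_range]
      refine lt_of_le_of_lt Finset.card_image_le ?_
      rw [← weight_eq]
      omega
    obtain ⟨c, hc, hcz⟩ := Finset.exists_mem_notMem_of_card_lt_card hcard
    rw [Finset.mem_range] at hc
    simp only [Finset.mem_image, not_exists, not_and] at hcz
    set p : Fin n := ⟨c, by omega⟩ with hp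
    set p' : Fin n := ⟨n - k + c, by omega⟩ with hp'
    have hpc : boxColumn n k p = c := by simp only [boxColumn, hp]; split_ifs <;> omega
    have hpc' : boxColumn n k p' = c := by simp only [boxColumn, hp']; split_ifs <;> omega
    have hne : t p ≠ t p' := fun h => by
      have := congrArg Fin.val (t.injective h)
      simp only [hp, hp'] at this
      omega
    have hti : ∀ l, t⁻¹ (t l) = l := fun l => t.symm_apply_apply l
    have hz1 : t p ∉ supp z := fun h => hcz _ h (by rw [hti, hpc])
    have hz2 : t p' ∉ supp z := fun h => hcz _ h (by rw [hti, hpc'])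
    rw [mem_supp, Bool.not_eq_true] at hz1 hz2
    set τ : Equiv.Perm (Fin n) := Equiv.swap (t p) (t p') with hτ
    have hτC : τ ∈ columnStabilizer k t := by
      rw [mem_columnStabilizer]
      intro l
      rw [hτ, Equiv.swap_apply_def]
      split_ifs with h h
      · rw [h, hti, hti, hpc, hpc']
      · rw [h, hti, hti, hpc, hpc']
      · rfl
    have hτz : τ • z = z := by
      funext l
      rw [smul_word_apply, hτ, Equiv.swap_inv, Equiv.swap_apply_def]
      split_ifs with h h
      · rw [h, hz1, hz2]
      · rw [h, hz1, hz2]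
      · rfl
    refine Finset.sum_involution (fun σ _ => τ * σ) ?_ ?_ ?_ ?_
    · intro σ _
      have : supp z ⊆ supp ((τ * σ) • tabloid k t) ↔ supp z ⊆ supp (σ • tabloid k t) := by
        rw [mul_smul]
        conv_lhs => rw [← hτz]
        exact supp_smul_subset_supp_smul τ
      by_cases h : supp z ⊆ supp (σ • tabloid k t)
      · rw [if_pos h, if_pos (this.2 h), Equiv.Perm.sign_mul, hτ, Equiv.Perm.sign_swap hne]
        simp
      · rw [if_neg h, if_neg (fun h' => h (this.1 h')), add_zero]
    · intro σ _ _ h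
      have h2 : τ = 1 := by simpa using h
      exact hne (Equiv.swap_eq_one_iff.1 (hτ ▸ h2))
    · intro σ hσ
      exact mul_mem_columnStabilizer hτC hσ
    · intro σ _
      rw [← mul_assoc, hτ, Equiv.swap_mul_self, one_mul]

/-- A column permutation fixing the tabloid preserves row and column of every entry, hence is the
identity. This makes the polytabloid nonzero. -/
theorem polytabloid_apply_tabloid {k : ℕ} (t : Equiv.Perm (Fin n)) :
    polytabloid 𝕜 k t (tabloid k t) = 1 := by
  rw [polytabloid_apply, Finset.sum_eq_single 1]
  · simp
  · intro σ hσ hσ1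
    refine if_neg fun h => hσ1 ?_
    rw [mem_columnStabilizer] at hσ
    refine Equiv.ext fun l => ?_
    have h1 := hσ l
    have h2 : tabloid k t (σ l) = tabloid k t l := by
      conv_lhs => rw [← h]
      rw [smul_word_apply, show σ⁻¹ (σ l) = l from σ.symm_apply_apply l]
    simp only [tabloid, decide_eq_decide] at h2
    have h3 : t⁻¹ (σ l) = t⁻¹ l := by
      refine Fin.ext ?_
      simp only [boxColumn] at h1
      split_ifs at h1 <;> omega
    exact t⁻¹.injective h3
  · intro h
    refine (h ?_).elim
    rw [mem_columnStabilizer]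
    simp

theorem tabloid_mul (k : ℕ) (σ t : Equiv.Perm (Fin n)) :
    tabloid k (σ * t) = σ • tabloid k t := by
  funext l
  simp [tabloid, smul_word_apply, mul_inv_rev]

theorem translate_polytabloid (k : ℕ) (σ t : Equiv.Perm (Fin n)) :
    translate σ (polytabloid 𝕜 k t) = polytabloid 𝕜 k (σ * t) := by
  funext x
  rw [translate_apply, polytabloid_apply, polytabloid_apply]
  refine Finset.sum_nbij' (fun ρ => σ * ρ * σ⁻¹) (fun ρ => σ⁻¹ * ρ * σ) ?_ ?_ ?_ ?_ ?_
  · intro ρ hρ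
    rw [mem_columnStabilizer] at *
    intro l
    simpa [mul_inv_rev] using hρ (σ⁻¹ l)
  · intro ρ hρ
    rw [mem_columnStabilizer] at *
    intro l
    simpa [mul_inv_rev] using hρ (σ l)
  · intro ρ _; group
  · intro ρ _; group
  · intro ρ _
    have : (σ * ρ * σ⁻¹) • tabloid k (σ * t) = x ↔ ρ • tabloid k t = σ⁻¹ • x := by
      rw [tabloid_mul, ← mul_smul, inv_mul_cancel_right, mul_smul, eq_inv_smul_iff]
    have hs : Equiv.Perm.sign (σ * ρ * σ⁻¹) = Equiv.Perm.sign ρ := by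
      rw [Equiv.Perm.sign_mul, Equiv.Perm.sign_mul, Equiv.Perm.sign_inv, mul_right_comm,
        Int.units_mul_self, one_mul]
    simp only [this, hs]

theorem isGSpace_specht (k : ℕ) : IsGSpace (Equiv.Perm (Fin n)) (specht 𝕜 n k) := by
  intro σ f hf
  induction hf using Submodule.span_induction with
  | mem f hf =>
    obtain ⟨t, rfl⟩ := hf
    simp only [translate_polytabloid]
    exact Submodule.subset_span ⟨_, rfl⟩
  | zero => exact Submodule.zero_mem _
  | add f g _ _ hf hg => exact Submodule.add_mem _ hf hg
  | smul c f _ hf => exact Submodule.smul_mem _ c hf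

theorem specht_ne_bot (k : ℕ) : specht 𝕜 n k ≠ ⊥ := by
  refine (Submodule.ne_bot_iff _).2 ⟨polytabloid 𝕜 k 1, Submodule.subset_span ⟨1, rfl⟩, fun h => ?_⟩
  have := polytabloid_apply_tabloid (𝕜 := 𝕜) (k := k) (1 : Equiv.Perm (Fin n))
  rw [h] at this
  simp at this

/-- The Specht module is a nonzero invariant subspace of a space that has no proper one. -/
theorem specht_eq_harmonic {k : ℕ} (hk : k ≤ n - k) (hn : k ≤ n) :
    specht 𝕜 n k = harmonic 𝕜 n k := by
  refine eq_harmonic_of_isGSpace hk ?_ (isGSpace_specht k) (specht_ne_bot k)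
  refine Submodule.span_le.2 ?_
  rintro _ ⟨t, rfl⟩
  exact polytabloid_mem_harmonic hk hn t

theorem harmonic_ne_bot {k : ℕ} (hk : k ≤ n - k) (hn : k ≤ n) : harmonic 𝕜 n k ≠ ⊥ :=
  specht_eq_harmonic (𝕜 := 𝕜) hk hn ▸ specht_ne_bot k

theorem harmonicKernel_mem_harmonic {k : ℕ} (hk : k ≤ n - k) (hn : k ≤ n) (y : BinWord n) :
    (fun x => harmonicKernel 𝕜 n k x y) ∈ harmonic 𝕜 n k :=
  harmonicKernel_mem_of_isGSpace hk le_rfl (isGSpace_harmonic k) (harmonic_ne_bot hk hn) y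

/-- The kernel matrix is a projection onto the space, so the dimension is its trace: C(n,k) diagonal
entries h_k / C(n,k). -/
theorem finrank_harmonic {k : ℕ} (hk : k ≤ n - k) (hn : k ≤ n) :
    (Module.finrank 𝕜 (harmonic 𝕜 n k) : ℝ) = hdim n k := by
  let Z : Matrix (BinWord n) (BinWord n) 𝕜 := Matrix.of fun x y => harmonicKernel 𝕜 n k x y
  have hZ : LinearMap.IsProj (harmonic 𝕜 n k) (Matrix.toLin' Z) := by
    constructor
    · intro g
      have : Matrix.toLin' Z g = ∑ y, g y • fun x => harmonicKernel 𝕜 n k x y := by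
        funext x
        simp [Z, Matrix.mulVec, dotProduct, mul_comm]
      rw [this]
      exact Submodule.sum_mem _ fun y _ =>
        Submodule.smul_mem _ _ (harmonicKernel_mem_harmonic hk hn y)
    · intro g hg
      funext x
      rw [← sum_harmonicKernel_mul hk hg x]
      simp [Z, Matrix.mulVec, dotProduct]
  have h1 := hZ.trace
  have h2 : Matrix.trace Z = (hdim n k : 𝕜) := by
    have h3 : Matrix.trace Z = ∑ x : BinWord n with weight x = k,
        ((hdim n k / (n.choose k : ℝ) : ℝ) : 𝕜) := by
      rw [Finset.sum_filter]
      refine Finset.sum_congr rfl fun x _ => ?_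
      simp only [Z, Matrix.diag_apply, Matrix.of_apply]
      split_ifs with hx
      · exact harmonicKernel_self hx
      · simp [harmonicKernel, hx]
    rw [h3, Finset.sum_const, card_filter_weight, nsmul_eq_mul]
    have h4 : (n.choose k : 𝕜) ≠ 0 := Nat.cast_ne_zero.2 (Nat.choose_pos hn).ne'
    push_cast
    field_simp
  rw [Matrix.trace_toLin'_eq, h2] at h1
  exact_mod_cast h1.symm

end Specht

/-! ### Formal properties of isometries and the inner product. -/

section GIsometry

variable {𝕜 X G : Type*} [RCLike 𝕜] [Group G] [MulAction G X] [Fintype X]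

/-- The inverse of a `G`-isometry onto a `G`-space. -/
def GIsometry.symm {H H' : Submodule 𝕜 (X → 𝕜)} (hH : IsGSpace G H) (φ : GIsometry G H H') :
    GIsometry G H' H where
  toEquiv := φ.toEquiv.symm
  map_translate a f hf := by
    have h := φ.map_translate a (φ.toEquiv.symm f) (hH a _ (φ.toEquiv.symm f).2)
    rw [LinearEquiv.apply_symm_apply] at h
    have h2 : (⟨translate a (f : X → 𝕜), hf⟩ : H') =
        φ.toEquiv ⟨translate a (φ.toEquiv.symm f : X → 𝕜), hH a _ (φ.toEquiv.symm f).2⟩ :=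
      Subtype.ext h.symm
    rw [h2, LinearEquiv.symm_apply_apply]
  map_ip f g := by
    rw [← φ.map_ip, LinearEquiv.apply_symm_apply, LinearEquiv.apply_symm_apply]

/-- The composition of `G`-isometries. -/
def GIsometry.trans {H H' H'' : Submodule 𝕜 (X → 𝕜)} (hH' : IsGSpace G H')
    (φ : GIsometry G H H') (ψ : GIsometry G H' H'') : GIsometry G H H'' where
  toEquiv := φ.toEquiv.trans ψ.toEquiv
  map_translate a f hf := by
    have h := φ.map_translate a f hf
    have h2 : φ.toEquiv ⟨translate a (f : X → 𝕜), hf⟩ =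
        ⟨translate a (φ.toEquiv f : X → 𝕜), hH' a _ (φ.toEquiv f).2⟩ := Subtype.ext h
    rw [LinearEquiv.trans_apply, LinearEquiv.trans_apply, h2, ψ.map_translate]
  map_ip f g := by
    rw [LinearEquiv.trans_apply, LinearEquiv.trans_apply, ψ.map_ip, φ.map_ip]

theorem ip_eq_zero_iff (f : X → 𝕜) : ip f f = 0 ↔ f = 0 := by
  constructor
  · intro h
    by_cases hX : IsEmpty X
    · exact Subsingleton.elim _ _
    rw [not_isEmpty_iff] at hX
    have h0 : (1 / (Fintype.card X : 𝕜)) ≠ 0 :=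
      one_div_ne_zero (Nat.cast_ne_zero.2 Fintype.card_ne_zero)
    have h1 := (mul_eq_zero.1 h).resolve_left h0
    simp only [RCLike.mul_conj] at h1
    have h2 : ∑ x, ‖f x‖ ^ 2 = 0 := by exact_mod_cast h1
    rw [Finset.sum_eq_zero_iff_of_nonneg fun x _ => by positivity] at h2
    funext x
    simpa using h2 x (Finset.mem_univ x)
  · rintro rfl
    simp [ip]

theorem ip_conj_symm (f g : X → 𝕜) : conj (ip f g) = ip g f := by
  simp [ip, mul_comm]

theorem ip_sum_left {ι : Type*} (s : Finset ι) (f : ι → X → 𝕜) (g : X → 𝕜) :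
    ip (∑ i ∈ s, f i) g = ∑ i ∈ s, ip (f i) g := by
  simp only [ip, Finset.sum_apply, Finset.sum_mul]
  rw [Finset.sum_comm, Finset.mul_sum]

theorem ip_smul_left (c : 𝕜) (f g : X → 𝕜) : ip (c • f) g = c * ip f g := by
  simp only [ip, Pi.smul_apply, smul_eq_mul, mul_assoc]
  rw [← Finset.mul_sum]
  ring

theorem ip_smul_right (c : 𝕜) (f g : X → 𝕜) : ip f (c • g) = conj c * ip f g := by
  rw [← ip_conj_symm, ip_smul_left, map_mul, ip_conj_symm]

end GIsometry

/-! ### Lifting harmonic functions to higher weights. -/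

section Levels

variable {𝕜 : Type*} [RCLike 𝕜] {n : ℕ}

theorem ip_levelSum (i : ℕ) (f g : BinWord n → 𝕜) :
    ip (levelSum 𝕜 n i f) (levelSum 𝕜 n i g) = 1 / (Fintype.card (BinWord n) : 𝕜) *
      ∑ x with weight x = i, subsetSum 𝕜 n f x * conj (subsetSum 𝕜 n g x) := by
  rw [ip, Finset.sum_filter]
  congr 1
  refine Finset.sum_congr rfl fun x _ => ?_
  simp only [levelSum_apply]
  split_ifs <;> simp

theorem ip_levelSum_of_ne {i i' : ℕ} (h : i ≠ i') (f g : BinWord n → 𝕜) :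
    ip (levelSum 𝕜 n i f) (levelSum 𝕜 n i' g) = 0 := by
  rw [ip, Finset.sum_eq_zero, mul_zero]
  intro x _
  simp only [levelSum_apply]
  split_ifs with h1 h2
  · exact (h (h1.symm.trans h2)).elim
  all_goals simp

/-- The square of the factor by which `levelSum` scales the norm of harmonic functions. -/
def levelNorm (n k i : ℕ) : ℕ := (n - k - k).choose (n - i - k)

theorem levelNorm_pos {k i : ℕ} (hki : k ≤ i) : 0 < levelNorm n k i :=
  Nat.choose_pos (by omega)

theorem ip_levelSum_harmonic {k i : ℕ} (hki : k ≤ i) (hin : i + k ≤ n) {f g : BinWord n → 𝕜}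
    (hf : f ∈ harmonic 𝕜 n k) (hg : g ∈ harmonic 𝕜 n k) :
    ip (levelSum 𝕜 n i f) (levelSum 𝕜 n i g) = (levelNorm n k i : 𝕜) * ip f g := by
  rw [ip_levelSum, sum_subsetSum_mul_conj (k' := k) (by omega) (by omega) (by omega) hf hg.1, ip]
  rw [levelNorm, mul_left_comm]
  congr 2
  refine Finset.sum_congr rfl fun y _ => ?_
  by_cases hy : weight y = k
  · rw [subsetSum_of_weight_eq hf.1 hy]
  · rw [hg.1 y hy]
    simp

/-- The pairing reduces to one over words of weight k', below which f has no support because k' < k.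
-/
theorem ip_levelSum_of_lt {k k' i : ℕ} (hkk : k' < k) (hin : i + k ≤ n) (hk : k ≤ i)
    {f g : BinWord n → 𝕜} (hf : f ∈ harmonic 𝕜 n k) (hg : g ∈ harmonic 𝕜 n k') :
    ip (levelSum 𝕜 n i f) (levelSum 𝕜 n i g) = 0 := by
  rw [ip_levelSum, sum_subsetSum_mul_conj (k' := k') (by omega) (by omega) (by omega) hf hg.1,
    Finset.sum_eq_zero, mul_zero, mul_zero]
  intro y _
  by_cases hy : weight y = k'
  · rw [subsetSum_of_weight_lt hf.1 (by omega), zero_mul]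
  · rw [hg.1 y hy]
    simp

theorem ip_levelSum_eq_zero (p q : Σ k : TypeIdx n, RowIdx n k) (hpq : p ≠ q)
    {f g : BinWord n → 𝕜} (hf : f ∈ harmonic 𝕜 n p.1) (hg : g ∈ harmonic 𝕜 n q.1) :
    ip (levelSum 𝕜 n p.2 f) (levelSum 𝕜 n q.2 g) = 0 := by
  by_cases hi : (p.2 : ℕ) = q.2
  swap
  · exact ip_levelSum_of_ne hi f g
  have hp := p.2.2
  have hq := q.2.2
  have h1 := p.1.2
  have h2 := q.1.2
  rcases lt_trichotomy (p.1 : ℕ) q.1 with h | h | h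
  · rw [← ip_conj_symm, hi, ip_levelSum_of_lt h (by omega) (by omega) hg hf, map_zero]
  · obtain ⟨k, i⟩ := p
    obtain ⟨k', i'⟩ := q
    obtain rfl : k = k' := Fin.ext h
    obtain rfl : i = i' := Subtype.ext hi
    exact (hpq rfl).elim
  · rw [← hi, ip_levelSum_of_lt h (by omega) (by omega) hf hg]

/-- The image of the harmonic functions on the words of weight `i`. -/
def levelSpace (𝕜 : Type*) [RCLike 𝕜] (n k i : ℕ) : Submodule 𝕜 (BinWord n → 𝕜) :=
  (harmonic 𝕜 n k).map (levelSum 𝕜 n i)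

theorem mem_levelSpace {k i : ℕ} {g : BinWord n → 𝕜} :
    g ∈ levelSpace 𝕜 n k i ↔ ∃ f ∈ harmonic 𝕜 n k, levelSum 𝕜 n i f = g := Iff.rfl

theorem isGSpace_levelSpace (k i : ℕ) : IsGSpace (Equiv.Perm (Fin n)) (levelSpace 𝕜 n k i) := by
  rintro σ _ ⟨f, hf, rfl⟩
  exact ⟨translate σ f, isGSpace_harmonic k σ f hf, levelSum_translate i σ f⟩

theorem levelSum_injective {k i : ℕ} (hki : k ≤ i) (hin : i + k ≤ n) {f : BinWord n → 𝕜}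
    (hf : f ∈ harmonic 𝕜 n k) (h : levelSum 𝕜 n i f = 0) : f = 0 := by
  have h1 := ip_levelSum_harmonic hki hin hf hf
  rw [h, (ip_eq_zero_iff _).2 rfl] at h1
  exact (ip_eq_zero_iff f).1 ((mul_eq_zero.1 h1.symm).resolve_left
    (Nat.cast_ne_zero.2 (levelNorm_pos hki).ne'))

/-- The factor that makes `levelSum` an isometry on harmonic functions. -/
def levelFactor (n k i : ℕ) : ℝ := (Real.sqrt (levelNorm n k i))⁻¹

theorem levelFactor_pos {k i : ℕ} (hki : k ≤ i) : 0 < levelFactor n k i :=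
  inv_pos.2 (Real.sqrt_pos.2 (Nat.cast_pos.2 (levelNorm_pos hki)))

theorem levelFactor_sq_mul {k i : ℕ} (hki : k ≤ i) :
    levelFactor n k i ^ 2 * levelNorm n k i = 1 := by
  rw [levelFactor, inv_pow, Real.sq_sqrt (Nat.cast_nonneg _)]
  exact inv_mul_cancel₀ (Nat.cast_ne_zero.2 (levelNorm_pos hki).ne')

theorem levelFactor_self (n k : ℕ) : levelFactor n k k = 1 := by
  simp [levelFactor, levelNorm]

theorem exists_gIsometry {k i : ℕ} (hki : k ≤ i) (hin : i + k ≤ n)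
    {H H' : Submodule 𝕜 (BinWord n → 𝕜)} (hH : H = harmonic 𝕜 n k)
    (hH' : H' = levelSpace 𝕜 n k i) :
    ∃ φ : GIsometry (Equiv.Perm (Fin n)) H H',
      ∀ f : H, (φ.toEquiv f : BinWord n → 𝕜) = (levelFactor n k i : 𝕜) • levelSum 𝕜 n i f := by
  subst hH hH'
  have hc : (levelFactor n k i : 𝕜) ≠ 0 := RCLike.ofReal_ne_zero.2 (levelFactor_pos hki).ne'
  let T : harmonic 𝕜 n k →ₗ[𝕜] levelSpace 𝕜 n k i :=
    LinearMap.codRestrict _ ((levelFactor n k i : 𝕜) • levelSum 𝕜 n i ∘ₗ (harmonic 𝕜 n k).subtype)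
      fun f => Submodule.smul_mem _ _ ⟨f, f.2, rfl⟩
  have hT : ∀ f, (T f : BinWord n → 𝕜) = (levelFactor n k i : 𝕜) • levelSum 𝕜 n i f :=
    fun f => rfl
  have hb : Function.Bijective T := by
    constructor
    · refine (injective_iff_map_eq_zero T).2 fun f hf => Subtype.ext ?_
      have h := congrArg Subtype.val hf
      rw [hT] at h
      exact levelSum_injective hki hin f.2 ((smul_eq_zero.1 h).resolve_left hc)
    · rintro ⟨_, f, hf, rfl⟩
      refine ⟨(levelFactor n k i : 𝕜)⁻¹ • ⟨f, hf⟩, Subtype.ext ?_⟩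
      rw [hT, Submodule.coe_smul, map_smul, smul_smul, mul_inv_cancel₀ hc, one_smul]
  refine ⟨⟨LinearEquiv.ofBijective T hb, fun σ f hf => ?_, fun f g => ?_⟩, fun f => rfl⟩
  · rw [LinearEquiv.ofBijective_apply, LinearEquiv.ofBijective_apply, hT, hT, levelSum_translate]
    rfl
  · rw [LinearEquiv.ofBijective_apply, LinearEquiv.ofBijective_apply, hT, hT, ip_smul_left,
      ip_smul_right, ip_levelSum_harmonic hki hin f.2 g.2, RCLike.conj_ofReal, ← mul_assoc,
      ← mul_assoc]
    have h := congrArg (RCLike.ofReal : ℝ → 𝕜) (levelFactor_sq_mul (n := n) hki)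
    push_cast at h
    rw [← pow_two, h, one_mul]

theorem isIrreducibleGSpace_levelSpace {k i : ℕ} (hki : k ≤ i) (hin : i + k ≤ n) :
    IsIrreducibleGSpace (Equiv.Perm (Fin n)) (levelSpace 𝕜 n k i) := by
  refine ⟨isGSpace_levelSpace k i, fun h => ?_, fun H' hlt hG => ?_⟩
  · refine harmonic_ne_bot (𝕜 := 𝕜) (n := n) (k := k) (by omega) (by omega) ?_
    refine (Submodule.eq_bot_iff _).2 fun f hf => levelSum_injective hki hin hf ?_
    exact (Submodule.eq_bot_iff _).1 h _ ⟨f, hf, rfl⟩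
  -- The pullback of H' to the harmonic functions is invariant, hence zero or everything.
  · let K := H'.comap (levelSum 𝕜 n i) ⊓ harmonic 𝕜 n k
    by_cases hK : K = ⊥
    · refine (Submodule.eq_bot_iff _).2 fun g hg => ?_
      obtain ⟨f, hf, rfl⟩ := hlt.le hg
      have : f ∈ K := ⟨hg, hf⟩
      rw [hK, Submodule.mem_bot] at this
      rw [this, map_zero]
    · have hKG : IsGSpace (Equiv.Perm (Fin n)) K := by
        rintro σ f ⟨h1, h2⟩
        refine ⟨?_, isGSpace_harmonic k σ f h2⟩
        have := hG σ _ h1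
        rwa [← levelSum_translate] at this
      have h1 := eq_harmonic_of_isGSpace (by omega) inf_le_right hKG hK
      refine (hlt.not_ge ?_).elim
      rintro _ ⟨f, hf, rfl⟩
      rw [SetLike.mem_coe, ← h1] at hf
      exact hf.1

theorem exists_smul_levelSum {k i : ℕ} {H H' : Submodule 𝕜 (BinWord n → 𝕜)}
    (hH : H ≤ harmonic 𝕜 n k) (hG : IsGSpace (Equiv.Perm (Fin n)) H)
    (hs : ∀ f ∈ H', ∀ x, weight x ≠ i → f x = 0) (φ : GIsometry (Equiv.Perm (Fin n)) H H') :
    ∃ c : 𝕜, ∀ f : H, (φ.toEquiv f : BinWord n → 𝕜) = c • levelSum 𝕜 n i f := by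
  obtain ⟨c, hc⟩ := exists_eq_mul_subsetSum hH hG (H'.subtype ∘ₗ φ.toEquiv.toLinearMap)
    (fun σ f => φ.map_translate σ f _) i
  refine ⟨c, fun f => ?_⟩
  funext x
  rw [Pi.smul_apply, levelSum_apply, smul_eq_mul]
  split_ifs with h
  · exact hc f x h
  · rw [mul_zero]
    exact hs _ (φ.toEquiv f).2 x h

/-- Uniqueness of the summands: an isometry from the harmonic space onto H is a nonzero multiple of
`levelSum` by Schur's lemma, so H is the image. -/
theorem eq_levelSpace {k i : ℕ} (hki : k ≤ i) (hin : i + k ≤ n)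
    {H : Submodule 𝕜 (BinWord n → 𝕜)} (hG : IsGSpace (Equiv.Perm (Fin n)) H)
    (hs : ∀ f ∈ H, ∀ x, weight x ≠ i → f x = 0)
    (he : GEquivalent (Equiv.Perm (Fin n)) H (specht 𝕜 n k)) : H = levelSpace 𝕜 n k i := by
  rw [specht_eq_harmonic (by omega) (by omega)] at he
  obtain ⟨ψ⟩ := he
  obtain ⟨c, hc⟩ := exists_smul_levelSum le_rfl (isGSpace_harmonic k) hs (ψ.symm hG)
  have hc0 : c ≠ 0 := by
    rintro rfl
    refine harmonic_ne_bot (𝕜 := 𝕜) (n := n) (k := k) (by omega) (by omega) ?_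
    refine (Submodule.eq_bot_iff _).2 fun f hf => ?_
    have h := hc ⟨f, hf⟩
    rw [zero_smul, ZeroMemClass.coe_eq_zero, LinearEquiv.map_eq_zero_iff] at h
    exact congrArg Subtype.val h
  refine le_antisymm (fun g hg => ?_) ?_
  · have h := hc (ψ.toEquiv ⟨g, hg⟩)
    have h2 : (ψ.symm hG).toEquiv (ψ.toEquiv ⟨g, hg⟩) = ⟨g, hg⟩ :=
      ψ.toEquiv.symm_apply_apply _
    rw [h2] at h
    rw [show g = _ from h]
    exact Submodule.smul_mem _ _ ⟨_, (ψ.toEquiv ⟨g, hg⟩).2, rfl⟩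
  · rintro _ ⟨f, hf, rfl⟩
    have h := hc ⟨f, hf⟩
    have h2 : levelSum 𝕜 n i f = c⁻¹ • ((ψ.symm hG).toEquiv ⟨f, hf⟩ : BinWord n → 𝕜) := by
      rw [h, smul_smul, inv_mul_cancel₀ hc0, one_smul]
    rw [h2]
    exact Submodule.smul_mem _ _ (Submodule.coe_mem _)

end Levels

/-! ### The level spaces form a decomposition. -/

section Existence

variable {𝕜 : Type*} [RCLike 𝕜] {n : ℕ}

instance rowIdxFintype (k : TypeIdx n) : Fintype (RowIdx n k) :=
  Fintype.subtype (Finset.Icc (k : ℕ) (n - k)) (by simp)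

theorem card_rowIdx (k : TypeIdx n) : Fintype.card (RowIdx n k) = n + 1 - k - k := by
  rw [Fintype.card_of_subtype (Finset.Icc (k : ℕ) (n - k)) (by simp), Nat.card_Icc]
  have := k.2
  omega

/-- Summation by parts: h_k is a difference of binomials, and n+1-2k drops by 2 at each step. -/
theorem sum_mul_hdim (n m : ℕ) :
    ∑ k ∈ Finset.range (m + 1), ((n : ℝ) + 1 - k - k) * hdim n k =
      ((n : ℝ) + 1 - m - m) * n.choose m + 2 * ∑ k ∈ Finset.range m, (n.choose k : ℝ) := by
  induction m with
  | zero => simp [hdim]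
  | succ m ih =>
    rw [Finset.sum_range_succ, ih, Finset.sum_range_succ _ m]
    simp only [hdim, Nat.add_eq_zero_iff, one_ne_zero, and_false, if_false, Nat.add_sub_cancel]
    push_cast
    ring

theorem sum_range_choose_succ (N m : ℕ) : ∑ k ∈ Finset.range (m + 1), ((N + 1).choose k : ℝ) =
    N.choose m + 2 * ∑ k ∈ Finset.range m, (N.choose k : ℝ) := by
  induction m with
  | zero => simp
  | succ m ih =>
    rw [Finset.sum_range_succ, ih, Finset.sum_range_succ _ m, Nat.choose_succ_succ]
    push_cast
    ring

/-- The type k occurs for n+1-2k values of i, so this is the total dimension. It reduces to half of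
an odd row of Pascal's triangle; for even n, Pascal's rule first passes to the next row. -/
theorem sum_mul_hdim_half (n : ℕ) :
    ∑ k ∈ Finset.range (n / 2 + 1), ((n : ℝ) + 1 - k - k) * hdim n k = 2 ^ n := by
  rw [sum_mul_hdim]
  rcases Nat.even_or_odd' n with ⟨m, rfl | rfl⟩
  · rw [show 2 * m / 2 = m by omega]
    have h := sum_range_choose_succ (2 * m) m
    have h2 := Nat.sum_range_choose_halfway m
    have h3 : ∑ k ∈ Finset.range (m + 1), ((2 * m + 1).choose k : ℝ) = 4 ^ m := by exact_mod_cast h2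
    rw [h3] at h
    rw [pow_mul, show (2 : ℝ) ^ 2 = 4 by norm_num, h]
    push_cast
    ring
  · rw [show (2 * m + 1) / 2 = m by omega]
    have h2 := Nat.sum_range_choose_halfway m
    have h3 : ∑ k ∈ Finset.range (m + 1), ((2 * m + 1).choose k : ℝ) = 4 ^ m := by exact_mod_cast h2
    rw [pow_succ, pow_mul, show (2 : ℝ) ^ 2 = 4 by norm_num, ← h3, Finset.sum_range_succ]
    push_cast
    ring

theorem sum_finrank_harmonic :
    ∑ p : (Σ k : TypeIdx n, RowIdx n k), Module.finrank 𝕜 (harmonic 𝕜 n p.1) = 2 ^ n := by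
  have h : ∑ p : (Σ k : TypeIdx n, RowIdx n k), (Module.finrank 𝕜 (harmonic 𝕜 n p.1) : ℝ) =
      2 ^ n := by
    rw [Fintype.sum_sigma, ← sum_mul_hdim_half, ← Fin.sum_univ_eq_sum_range
      (fun k => ((n : ℝ) + 1 - k - k) * hdim n k)]
    refine Finset.sum_congr rfl fun k _ => ?_
    have hk := k.2
    change ∑ _i : RowIdx n k, (Module.finrank 𝕜 (harmonic 𝕜 n k) : ℝ) = _
    rw [Finset.sum_const, Finset.card_univ, card_rowIdx, nsmul_eq_mul,
      finrank_harmonic (by omega) (by omega), Nat.cast_sub (by omega), Nat.cast_sub (by omega)]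
    push_cast
    ring
  exact_mod_cast h

theorem iSup_levelSpace :
    (⨆ (k : TypeIdx n) (i : RowIdx n k), levelSpace 𝕜 n k i) = ⊤ := by
  let Φ : (∀ p : (Σ k : TypeIdx n, RowIdx n k), harmonic 𝕜 n p.1) →ₗ[𝕜] (BinWord n → 𝕜) :=
    ∑ p : (Σ k : TypeIdx n, RowIdx n k),
      levelSum 𝕜 n p.2 ∘ₗ (harmonic 𝕜 n p.1).subtype ∘ₗ LinearMap.proj p
  have hΦ : ∀ F, Φ F = ∑ p : (Σ k : TypeIdx n, RowIdx n k), levelSum 𝕜 n p.2 (F p) := fun F => by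
    simp [Φ, LinearMap.sum_apply]
  have hinj : Function.Injective Φ := by
    refine (injective_iff_map_eq_zero Φ).2 fun F hF => ?_
    funext q
    have hq := q.2.2
    have hq2 := q.1.2
    -- Orthogonality isolates the component q. Injectivity then gives surjectivity, because the
    -- dimensions agree.
    have h1 : ip (Φ F) (levelSum 𝕜 n q.2 (F q)) = 0 := by rw [hF]; simp [ip]
    rw [hΦ, ip_sum_left, Finset.sum_eq_single q] at h1
    · rw [ip_levelSum_harmonic (by omega) (by omega) (F q).2 (F q).2] at h1
      have h2 := (mul_eq_zero.1 h1).resolve_left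
        (Nat.cast_ne_zero.2 (levelNorm_pos (by omega)).ne')
      exact Subtype.ext ((ip_eq_zero_iff _).1 h2)
    · intro p _ hpq
      exact ip_levelSum_eq_zero p q hpq (F p).2 (F q).2
    · simp
  have hdimeq : Module.finrank 𝕜 (∀ p : (Σ k : TypeIdx n, RowIdx n k), harmonic 𝕜 n p.1) =
      Module.finrank 𝕜 (BinWord n → 𝕜) := by
    rw [Module.finrank_pi_fintype, sum_finrank_harmonic, Module.finrank_fintype_fun_eq_card]
    simp
  have hsurj := (LinearMap.injective_iff_surjective_of_finrank_eq_finrank hdimeq).1 hinj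
  refine eq_top_iff.2 fun g _ => ?_
  obtain ⟨F, rfl⟩ := hsurj g
  rw [hΦ]
  refine Submodule.sum_mem _ fun p _ => ?_
  exact Submodule.mem_iSup_of_mem p.1 (Submodule.mem_iSup_of_mem p.2 ⟨F p, (F p).2, rfl⟩)

theorem gEquivalent_harmonic_levelSpace {k i : ℕ} (hki : k ≤ i) (hin : i + k ≤ n) :
    GEquivalent (Equiv.Perm (Fin n)) (harmonic 𝕜 n k) (levelSpace 𝕜 n k i) :=
  ⟨(exists_gIsometry hki hin rfl rfl).choose⟩

/-- By Schur's lemma an isometry would be a multiple of `levelSum` at weight k' < k, which kills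
functions supported on weight k. -/
theorem not_gEquivalent_harmonic {k k' : ℕ} (hkk : k' < k) (hk : k ≤ n - k) (hn : k ≤ n) :
    ¬ GEquivalent (Equiv.Perm (Fin n)) (harmonic 𝕜 n k) (harmonic 𝕜 n k') := by
  rintro ⟨φ⟩
  obtain ⟨c, hc⟩ := exists_smul_levelSum le_rfl (isGSpace_harmonic k) (i := k')
    (fun f (hf : f ∈ harmonic 𝕜 n k') => hf.1) φ
  refine harmonic_ne_bot (𝕜 := 𝕜) hk hn ((Submodule.eq_bot_iff _).2 fun f hf => ?_)
  have h := hc ⟨f, hf⟩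
  have h0 : levelSum 𝕜 n k' f = 0 := by
    funext x
    rw [levelSum_apply]
    split_ifs with hx
    · exact subsetSum_of_weight_lt hf.1 (by omega)
    · rfl
  rw [h0, smul_zero, ZeroMemClass.coe_eq_zero, LinearEquiv.map_eq_zero_iff] at h
  exact congrArg Subtype.val h

theorem gEquivalent_levelSpace_iff (k k' : TypeIdx n) (i : RowIdx n k) (i' : RowIdx n k') :
    GEquivalent (Equiv.Perm (Fin n)) (levelSpace 𝕜 n k i) (levelSpace 𝕜 n k' i') ↔ k = k' := by
  have hk := k.2
  have hk' := k'.2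
  have hi := i.2
  have hi' := i'.2
  obtain ⟨φ⟩ := gEquivalent_harmonic_levelSpace (𝕜 := 𝕜) (n := n) hi.1 (by omega)
  obtain ⟨φ'⟩ := gEquivalent_harmonic_levelSpace (𝕜 := 𝕜) (n := n) hi'.1 (by omega)
  constructor
  · rintro ⟨ψ⟩
    let χ := (φ.trans (isGSpace_levelSpace _ _) ψ).trans (isGSpace_levelSpace _ _)
      (φ'.symm (isGSpace_harmonic _))
    rcases lt_trichotomy (k : ℕ) k' with h | h | h
    · exact (not_gEquivalent_harmonic h (by omega) (by omega)
        ⟨χ.symm (isGSpace_harmonic _)⟩).elim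
    · exact Fin.ext h
    · exact (not_gEquivalent_harmonic h (by omega) (by omega) ⟨χ⟩).elim
  · rintro rfl
    exact ⟨(φ.symm (isGSpace_harmonic _)).trans (isGSpace_harmonic _) φ'⟩

theorem isBinaryDecomposition_levelSpace :
    IsBinaryDecomposition fun (k : TypeIdx n) (i : RowIdx n k) => levelSpace 𝕜 n k i where
  irreducible k i := by
    have hk := k.2
    have hi := i.2
    exact isIrreducibleGSpace_levelSpace (by omega) (by omega)
  orthogonal := by
    rintro p q hpq _ ⟨f, hf, rfl⟩ _ ⟨g, hg, rfl⟩
    exact ip_levelSum_eq_zero p q hpq hf hg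
  iSup_eq_top := iSup_levelSpace
  equivalent_iff := gEquivalent_levelSpace_iff
  supported := by
    rintro k i _ ⟨f, _, rfl⟩ x hx
    rw [levelSum_apply, if_neg hx]
  partition_type k i := by
    have hk := k.2
    have hi := i.2
    rw [specht_eq_harmonic (by omega) (by omega)]
    obtain ⟨φ⟩ := gEquivalent_harmonic_levelSpace (𝕜 := 𝕜) (n := n) hi.1 (by omega)
    exact ⟨φ.symm (isGSpace_harmonic _)⟩

end Existence

/-! ### Evaluation of the block matrices. -/

section BlockMatrix

variable {𝕜 : Type*} [RCLike 𝕜] {n : ℕ}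

/-- An orthonormal basis of the harmonic functions gives their reproducing kernel. -/
theorem sum_orthonormalBasis_eq_harmonicKernel {k r : ℕ} (hk : k ≤ n - k) (hn : k ≤ n)
    {H : Submodule 𝕜 (BinWord n → 𝕜)} (hH : H = harmonic 𝕜 n k) {e : Fin r → H}
    (he : IsOrthonormalBasis e) (x y : BinWord n) :
    1 / (Fintype.card (BinWord n) : 𝕜) *
      ∑ l, (e l : BinWord n → 𝕜) x * conj ((e l : BinWord n → 𝕜) y) =
      harmonicKernel 𝕜 n k x y := by
  subst hH
  set P : BinWord n → BinWord n → 𝕜 := fun x y => 1 / (Fintype.card (BinWord n) : 𝕜) *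
      ∑ l, (e l : BinWord n → 𝕜) x * conj ((e l : BinWord n → 𝕜) y) with hP
  have hconj : ∀ x y, conj (P x y) = P y x := fun x y => by
    simp only [hP, map_mul, map_div₀, map_one, map_natCast, map_sum, RCLike.conj_conj]
    simp only [mul_comm]
  have hrep : ∀ g ∈ harmonic 𝕜 n k, ∀ x, ∑ y, P x y * g y = g x := by
    intro g hg x
    have hmem : (⟨g, hg⟩ : harmonic 𝕜 n k) ∈ Submodule.span 𝕜 (Set.range e) := by
      rw [he.2]; trivial
    obtain ⟨a, ha⟩ := (Submodule.mem_span_range_iff_exists_fun 𝕜).1 hmem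
    have hga : g = ∑ l, a l • (e l : BinWord n → 𝕜) := by
      have := congrArg Subtype.val ha
      simpa using this.symm
    have hip : ∀ l, ip g (e l : BinWord n → 𝕜) = a l := by
      intro l
      rw [hga, ip_sum_left]
      simp_rw [ip_smul_left, he.1]
      simp
    have h1 : ∑ y, P x y * g y = ∑ l, (e l : BinWord n → 𝕜) x * ip g (e l : BinWord n → 𝕜) := by
      simp only [hP, ip, Finset.mul_sum, Finset.sum_mul]
      rw [Finset.sum_comm]
      exact Finset.sum_congr rfl fun l _ => Finset.sum_congr rfl fun y _ => by ring
    rw [h1]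
    simp_rw [hip]
    rw [hga]
    simp [mul_comm]
  have hmemP : ∀ y, (fun x => P x y) ∈ harmonic 𝕜 n k := by
    intro y
    have : (fun x => P x y) = ∑ l, (1 / (Fintype.card (BinWord n) : 𝕜) *
        conj ((e l : BinWord n → 𝕜) y)) • (e l : BinWord n → 𝕜) := by
      funext x
      simp only [hP, Finset.mul_sum, Finset.sum_apply, Pi.smul_apply, smul_eq_mul]
      exact Finset.sum_congr rfl fun l _ => by ring
    rw [this]
    exact Submodule.sum_mem _ fun l _ => Submodule.smul_mem _ _ (e l).2
  -- Both kernels are Hermitian, have columns in the space and reproduce it; composing them gives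
  -- each of the two, so they coincide.
  have h1 := hrep _ (harmonicKernel_mem_harmonic hk hn y) x
  have h2 := congrArg conj (sum_harmonicKernel_mul hk (hmemP x) y)
  rw [hconj, map_sum] at h2
  change P x y = _
  rw [← h1, ← h2]
  refine Finset.sum_congr rfl fun z _ => ?_
  rw [map_mul, conj_harmonicKernel, hconj, harmonicKernel_comm, mul_comm]

/-- The sum of the reproducing kernel over the words below two given words. -/
theorem sum_sum_harmonicKernel {k i j : ℕ} (hki : k ≤ i) (hin : i + k ≤ n) (hkj : k ≤ j)
    (hjn : j + k ≤ n) {x y : BinWord n} (hx : weight x = i) (hy : weight y = j) :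
    ∑ x' with supp x' ⊆ supp x, ∑ y' with supp y' ⊆ supp y, harmonicKernel 𝕜 n k x' y' =
      ((levelNorm n k j * (hdim n k / n.choose k) / (n - k).choose (n - j) * i.choose k *
        hahnQ k (vdiff x y) (n - j) j i : ℝ) : 𝕜) := by
  have hk : k ≤ n - k := by omega
  have hn : k ≤ n := by omega
  set F : BinWord n → BinWord n → 𝕜 :=
    fun x' y => ∑ y' with supp y' ⊆ supp y, harmonicKernel 𝕜 n k x' y' with hF
  have hFinv : ∀ (σ : Equiv.Perm (Fin n)) (x y), F (σ • x) (σ • y) = F x y := by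
    intro σ x y
    simp only [hF]
    rw [sum_filter_smul σ _ (fun y' => supp y' ⊆ supp y) fun y' => supp_smul_subset_supp_smul σ]
    simp_rw [harmonicKernel_smul]
  have hFmem : ∀ y, (fun x' => F x' y) ∈ harmonic 𝕜 n k := by
    intro y
    have : (fun x' => F x' y) =
        ∑ y' with supp y' ⊆ supp y, fun x' => harmonicKernel 𝕜 n k x' y' := by
      funext x'
      simp [hF]
    rw [this]
    exact Submodule.sum_mem _ fun y' _ => harmonicKernel_mem_harmonic hk hn y'
  obtain ⟨q, hq⟩ := exists_vdiff_function (k := k) (j := j) F hFinv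
  -- As a function of x', F is harmonic and depends only on the difference from y, so its profile is
  -- fixed up to q(0).
  have hqv : ∀ t ≤ k, q t = (-1) ^ t * ((j - k + t).choose t : 𝕜) / ((n - j).choose t : 𝕜) * q 0 := by
    intro t ht
    have h1 := mul_choose_eq_of_harmonic hkj (hFmem y) hy (fun x' hx' => hq x' y hx' hy) ht
    have h2 : ((n - j).choose t : 𝕜) ≠ 0 := Nat.cast_ne_zero.2 (Nat.choose_pos (by omega)).ne'
    rw [div_mul_eq_mul_div, eq_div_iff h2, h1]
  -- Pair the kernel column of w with the point mass at w. At weight j, each of the C(n-k,n-j) words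
  -- above w contributes q(0); the norm identity equates the total with `levelNorm` times the
  -- diagonal kernel value.
  have hq0 : q 0 = ((levelNorm n k j * (hdim n k / n.choose k) / (n - k).choose (n - j) : ℝ) : 𝕜) := by
    obtain ⟨w, hw⟩ : ∃ w : BinWord n, weight w = k := by
      have : 0 < (Finset.univ.filter fun z : BinWord n => weight z = k).card := by
        rw [card_filter_weight]
        exact Nat.choose_pos hn
      obtain ⟨w, hw⟩ := Finset.card_pos.1 this
      exact ⟨w, (Finset.mem_filter.1 hw).2⟩
    have hd : ∀ z, weight z ≠ k → (Pi.single w 1 : BinWord n → 𝕜) z = 0 := by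
      intro z hz
      rw [Pi.single_apply, if_neg]
      rintro rfl
      exact hz hw
    have hg := sum_subsetSum_mul_conj (i := j) (by omega) hk (by omega)
      (harmonicKernel_mem_harmonic (𝕜 := 𝕜) hk hn w) hd
    have hs : ∀ z, subsetSum 𝕜 n (Pi.single w 1) z = if supp w ⊆ supp z then 1 else 0 := by
      intro z
      rw [subsetSum_apply, Finset.sum_filter]
      simp_rw [Pi.single_apply]
      rw [Finset.sum_eq_single w]
      · simp
      · intro b _ hb
        simp [hb]
      · simp
    have hR : ∑ z, subsetSum 𝕜 n (fun x => harmonicKernel 𝕜 n k x w) z *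
        conj ((Pi.single w 1 : BinWord n → 𝕜) z) = ((hdim n k / n.choose k : ℝ) : 𝕜) := by
      rw [Finset.sum_eq_single w]
      · rw [subsetSum_of_weight_eq (harmonicKernel_mem_harmonic hk hn w).1 hw,
          harmonicKernel_self hw]
        simp
      · intro b _ hb
        simp [hb]
      · simp
    have hL : ∑ z with weight z = j, subsetSum 𝕜 n (fun x => harmonicKernel 𝕜 n k x w) z *
        conj (subsetSum 𝕜 n (Pi.single w 1) z) = ((n - k).choose (n - j) : 𝕜) * q 0 := by
      have hc := card_filter_weight_superset (supp w) (show j ≤ n by omega)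
      rw [← weight_eq, hw] at hc
      rw [← hc, ← nsmul_eq_mul, ← Finset.sum_const, ← Finset.filter_filter, Finset.sum_filter
        (fun z : BinWord n => supp w ⊆ supp z)]
      refine Finset.sum_congr rfl fun z hz => ?_
      rw [hs]
      split_ifs with hwz
      · have h1 := hq w z hw (Finset.mem_filter.1 hz).2
        rw [vdiff_eq_zero.2 hwz] at h1
        rw [← h1, map_one, mul_one, subsetSum_apply]
        exact Finset.sum_congr rfl fun y' _ => harmonicKernel_comm _ _ _
      · simp
    rw [hL, hR] at hg
    have h2 : ((n - k).choose (n - j) : 𝕜) ≠ 0 :=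
      Nat.cast_ne_zero.2 (Nat.choose_pos (by omega)).ne'
    rw [RCLike.ofReal_div, RCLike.ofReal_mul, RCLike.ofReal_natCast, RCLike.ofReal_natCast,
      eq_div_iff h2, mul_comm, hg, levelNorm]
  -- With v = `vdiff x y`, there are C(v,t) C(i-v,k-t) words of weight k below x at difference t
  -- from y: the binomials of the Hahn polynomial.
  have hsum : ∑ x' with supp x' ⊆ supp x, F x' y = ∑ t ∈ Finset.range (k + 1),
      ((vdiff x y).choose t : 𝕜) * ((i - vdiff x y).choose (k - t) : 𝕜) * q t := by
    have h1 : ∀ x', F x' y = ∑ t ∈ Finset.range (k + 1),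
        if weight x' = k ∧ vdiff x' y = t then q t else 0 := by
      intro x'
      by_cases hx' : weight x' = k
      · simp only [hx', true_and]
        rw [Finset.sum_ite_eq, if_pos, hq x' y hx' hy]
        have := vdiff_le_weight x' y
        simp only [Finset.mem_range]
        omega
      · simp only [hx', false_and, if_false, Finset.sum_const_zero]
        exact (hFmem y).1 x' hx'
    simp_rw [h1]
    rw [Finset.sum_comm]
    refine Finset.sum_congr rfl fun t ht => ?_
    have ht' : t ≤ k := by simpa [Nat.lt_succ_iff] using ht
    have hc := card_filter_weight_vdiff_subset y x ht'
    rw [← Finset.sum_filter, Finset.sum_const, nsmul_eq_mul, ← Nat.cast_mul, ← hx, ← hc,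
      Finset.filter_filter]
    congr 3
    ext z
    simp only [Finset.mem_filter, Finset.mem_univ, true_and]
    tauto
  have hi0 : (i.choose k : ℝ) ≠ 0 := Nat.cast_ne_zero.2 (Nat.choose_pos hki).ne'
  have hh : (i.choose k : ℝ) * hahnQ k (vdiff x y) (n - j) j i = ∑ t ∈ Finset.range (k + 1),
      (-1 : ℝ) ^ t * (((j - k + t).choose t : ℝ) / ((n - j).choose t : ℝ)) *
      ((i - vdiff x y).choose (k - t) : ℝ) * ((vdiff x y).choose t : ℝ) := by
    rw [hahnQ, ← mul_assoc, mul_one_div_cancel hi0, one_mul]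
  rw [mul_assoc, hh, RCLike.ofReal_mul, ← hq0, hsum]
  push_cast
  rw [Finset.mul_sum]
  refine Finset.sum_congr rfl fun t ht => ?_
  rw [hqv t (by simpa [Nat.lt_succ_iff] using ht)]
  ring

theorem poch_neg (m k : ℕ) : poch (-(m : ℝ)) k = (-1) ^ k * (k.factorial * m.choose k) := by
  rw [poch, ascPochhammer_eval_neg_eq_descPochhammer, descPochhammer_eval_eq_descFactorial,
    Nat.descFactorial_eq_factorial_mul_choose, Nat.cast_mul]

/-- All arguments are negatives of natural numbers, so each symbol is (-1)^k k! times a binomial,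
and the common factors cancel. -/
theorem poch_quotient {k i j : ℕ} (hin : i ≤ n) (hjn : j ≤ n) :
    poch (-(j : ℝ)) k * poch ((i : ℝ) - n) k / (poch (-(i : ℝ)) k * poch ((j : ℝ) - n) k) =
      (j.choose k * (n - i).choose k) / (i.choose k * (n - j).choose k) := by
  have h : ∀ i ≤ n, (i : ℝ) - n = -((n - i : ℕ) : ℝ) := fun i hi => by
    rw [Nat.cast_sub hi]; ring
  rw [h i hin, h j hjn, poch_neg, poch_neg, poch_neg, poch_neg]
  have h1 : ((-1 : ℝ) ^ k * k.factorial) ^ 2 ≠ 0 :=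
    pow_ne_zero _ (mul_ne_zero (pow_ne_zero _ (by norm_num))
      (Nat.cast_ne_zero.2 (Nat.factorial_ne_zero k)))
  rw [← mul_div_mul_left _ ((i.choose k : ℝ) * (n - j).choose k) h1]
  congr 1 <;> ring

/-- Both sides are positive, so their squares may be compared; `hA` and `hB` express everything
through a few common binomials. -/
theorem normConst_eq {k i j : ℕ} (hki : k ≤ i) (hin : i + k ≤ n) (hkj : k ≤ j)
    (hjn : j + k ≤ n) :
    levelFactor n k i * levelFactor n k j *
      (levelNorm n k j * (hdim n k / n.choose k) / (n - k).choose (n - j) * i.choose k) =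
      normConst n k i j := by
  have hpos : ∀ {a b : ℕ}, b ≤ a → (0 : ℝ) < a.choose b := fun h =>
    Nat.cast_pos.2 (Nat.choose_pos h)
  have hA : ∀ i, k ≤ i → i + k ≤ n →
      (n.choose i : ℝ) = n.choose k * (n - k).choose (n - i) / i.choose k := by
    intro i h1 h2
    rw [eq_div_iff (hpos h1).ne']
    have := Nat.choose_mul (n := n) h1
    rw [← Nat.choose_symm (show i - k ≤ n - k by omega), show n - k - (i - k) = n - i by omega]
      at this
    exact_mod_cast this
  have hB : ∀ i, k ≤ i → i + k ≤ n →
      (levelNorm n k i : ℝ) = (n - k).choose (n - i) * (n - i).choose k / (n - k).choose k := by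
    intro i h1 h2
    rw [eq_div_iff (hpos (by omega)).ne']
    have := Nat.choose_mul (n := n - k) (show k ≤ n - i by omega)
    rw [levelNorm, mul_comm]
    exact_mod_cast this.symm
  have hd := hdim_pos (n := n) (k := k) (by omega) (by omega)
  have h1 := hpos hki
  have h2 := hpos hkj
  have h3 := hpos (show k ≤ n by omega)
  have h4 := hpos (show k ≤ n - i by omega)
  have h5 := hpos (show k ≤ n - j by omega)
  have h6 := hpos (show n - i ≤ n - k by omega)
  have h7 := hpos (show n - j ≤ n - k by omega)
  have h8 := hpos (show k ≤ n - k by omega)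
  have hNi := levelFactor_pos (n := n) hki
  have hNj := levelFactor_pos (n := n) hkj
  have hN := Nat.cast_pos (α := ℝ).2 (levelNorm_pos (n := n) hkj)
  have hci := hpos (show i ≤ n by omega)
  have hcj := hpos (show j ≤ n by omega)
  rw [normConst, poch_quotient (by omega) (by omega), Real.rpow_neg (by positivity),
    ← Real.sqrt_eq_rpow]
  refine (pow_left_inj₀ (by positivity) (by positivity) two_ne_zero).1 ?_
  have e1 : ∀ i, k ≤ i → levelFactor n k i ^ 2 = (levelNorm n k i : ℝ)⁻¹ := fun i hi =>
    eq_inv_of_mul_eq_one_left (levelFactor_sq_mul hi)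
  simp only [mul_pow, div_pow, inv_pow]
  rw [e1 i hki, e1 j hkj,
    Real.sq_sqrt (by positivity), Real.sq_sqrt (by positivity), hA i hki hin, hA j hkj hjn,
    hB i hki hin, hB j hkj hjn]
  field_simp

theorem blockMatrix_eq_zero {H H' H₁ : Submodule 𝕜 (BinWord n → 𝕜)} {r i j : ℕ} (e : Fin r → H₁)
    (φ : GIsometry (Equiv.Perm (Fin n)) H₁ H) (ψ : GIsometry (Equiv.Perm (Fin n)) H₁ H')
    (hH : ∀ f ∈ H, ∀ x, weight x ≠ i → f x = 0) (hH' : ∀ f ∈ H', ∀ x, weight x ≠ j → f x = 0)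
    {x y : BinWord n} (hxy : weight x ≠ i ∨ weight y ≠ j) : blockMatrix e φ ψ x y = 0 := by
  simp only [blockMatrix, Matrix.of_apply]
  rw [Finset.sum_eq_zero, mul_zero]
  intro l _
  rcases hxy with h | h
  · rw [hH _ (φ.toEquiv (e l)).2 x h, zero_mul]
  · rw [hH' _ (ψ.toEquiv (e l)).2 y h, map_zero, mul_zero]

theorem blockMatrix_conjTranspose {H H' H₁ : Submodule 𝕜 (BinWord n → 𝕜)} {r : ℕ}
    (e : Fin r → H₁) (φ : GIsometry (Equiv.Perm (Fin n)) H₁ H)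
    (ψ : GIsometry (Equiv.Perm (Fin n)) H₁ H') :
    blockMatrix e ψ φ = (blockMatrix e φ ψ).conjTranspose := by
  ext x y
  simp [blockMatrix, Matrix.conjTranspose_apply, mul_comm]

theorem blockMatrix_eq_sum {H H' H₁ : Submodule 𝕜 (BinWord n → 𝕜)} {k r i j : ℕ}
    (hk : k ≤ n - k) (hn : k ≤ n) (hH₁ : H₁ = harmonic 𝕜 n k) {e : Fin r → H₁}
    (he : IsOrthonormalBasis e) (φ : GIsometry (Equiv.Perm (Fin n)) H₁ H)
    (ψ : GIsometry (Equiv.Perm (Fin n)) H₁ H') {c d : 𝕜}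
    (hφ : ∀ f, (φ.toEquiv f : BinWord n → 𝕜) = c • levelSum 𝕜 n i f)
    (hψ : ∀ f, (ψ.toEquiv f : BinWord n → 𝕜) = d • levelSum 𝕜 n j f)
    {x y : BinWord n} (hx : weight x = i) (hy : weight y = j) :
    blockMatrix e φ ψ x y = c * conj d *
      ∑ x' with supp x' ⊆ supp x, ∑ y' with supp y' ⊆ supp y, harmonicKernel 𝕜 n k x' y' := by
  simp_rw [← sum_orthonormalBasis_eq_harmonicKernel hk hn hH₁ he]
  simp only [blockMatrix, Matrix.of_apply, hφ, hψ, Pi.smul_apply, smul_eq_mul, levelSum_apply, hx,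
    hy, if_true, map_mul]
  rw [Finset.sum_congr rfl fun x' _ => (Finset.mul_sum _ _ _).symm, ← Finset.mul_sum,
    mul_left_comm]
  congr 1
  rw [Finset.sum_congr rfl fun x' _ => Finset.sum_comm, Finset.sum_comm, Finset.mul_sum]
  refine Finset.sum_congr rfl fun l _ => ?_
  rw [← Finset.sum_mul_sum, subsetSum_apply, subsetSum_apply, map_sum]
  ring

theorem blockMatrix_eq {H H' H₁ : Submodule 𝕜 (BinWord n → 𝕜)} {k r i j : ℕ}
    (hki : k ≤ i) (hin : i + k ≤ n) (hkj : k ≤ j) (hjn : j + k ≤ n)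
    (hH₁ : H₁ = harmonic 𝕜 n k) {e : Fin r → H₁}
    (he : IsOrthonormalBasis e) (φ : GIsometry (Equiv.Perm (Fin n)) H₁ H)
    (ψ : GIsometry (Equiv.Perm (Fin n)) H₁ H') {c d : 𝕜}
    (hφ : ∀ f, (φ.toEquiv f : BinWord n → 𝕜) = (c * levelFactor n k i) • levelSum 𝕜 n i f)
    (hψ : ∀ f, (ψ.toEquiv f : BinWord n → 𝕜) = (d * levelFactor n k j) • levelSum 𝕜 n j f)
    {x y : BinWord n} (hx : weight x = i) (hy : weight y = j) :
    blockMatrix e φ ψ x y = c * conj d *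
      ((normConst n k i j * hahnQ k (vdiff x y) (n - j) j i : ℝ) : 𝕜) := by
  rw [blockMatrix_eq_sum (by omega) (by omega) hH₁ he φ ψ hφ hψ hx hy,
    sum_sum_harmonicKernel hki hin hkj hjn hx hy, ← normConst_eq hki hin hkj hjn, map_mul,
    RCLike.conj_ofReal]
  push_cast
  ring

/-- Schur's lemma gives a scalar c, and preservation of the norm of one nonzero function forces |c|
to be `levelFactor`. -/
theorem exists_norm_eq_one {H H₁ : Submodule 𝕜 (BinWord n → 𝕜)} {k i : ℕ}
    (hki : k ≤ i) (hin : i + k ≤ n) (hH₁ : H₁ = harmonic 𝕜 n k)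
    (hs : ∀ f ∈ H, ∀ x, weight x ≠ i → f x = 0) (φ : GIsometry (Equiv.Perm (Fin n)) H₁ H) :
    ∃ ε : 𝕜, ‖ε‖ = 1 ∧
      ∀ f, (φ.toEquiv f : BinWord n → 𝕜) = (ε * levelFactor n k i) • levelSum 𝕜 n i f := by
  subst hH₁
  obtain ⟨c, hc⟩ := exists_smul_levelSum le_rfl (isGSpace_harmonic k) hs φ
  obtain ⟨f, hf, hf0⟩ := Submodule.exists_mem_ne_zero_of_ne_bot
    (harmonic_ne_bot (𝕜 := 𝕜) (n := n) (k := k) (by omega) (by omega))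
  have h1 := φ.map_ip ⟨f, hf⟩ ⟨f, hf⟩
  rw [hc, ip_smul_left, ip_smul_right, ip_levelSum_harmonic hki hin hf hf, ← mul_assoc,
    ← mul_assoc, RCLike.mul_conj] at h1
  have h2 : ip f f ≠ 0 := fun h => hf0 ((ip_eq_zero_iff f).1 h)
  have h3 : (‖c‖ : 𝕜) ^ 2 * (levelNorm n k i : 𝕜) = 1 := mul_right_cancel₀ h2 (by rw [h1, one_mul])
  have h4 : ‖c‖ ^ 2 * (levelNorm n k i : ℝ) = 1 := by exact_mod_cast h3
  have hN : (levelNorm n k i : ℝ) ≠ 0 := Nat.cast_ne_zero.2 (levelNorm_pos hki).ne'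
  have hl := levelFactor_pos (n := n) hki
  have h5 : ‖c‖ = levelFactor n k i := by
    refine (pow_left_inj₀ (norm_nonneg _) hl.le two_ne_zero).1 (mul_right_cancel₀ hN ?_)
    rw [h4, levelFactor_sq_mul hki]
  refine ⟨c / levelFactor n k i, ?_, fun f => ?_⟩
  · rw [norm_div, RCLike.norm_ofReal, abs_of_pos hl, h5, div_self hl.ne']
  · rw [hc, div_mul_cancel₀ _ (RCLike.ofReal_ne_zero.2 hl.ne')]

theorem levelSpace_self (k : ℕ) : levelSpace 𝕜 n k k = harmonic 𝕜 n k := by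
  ext f
  rw [mem_levelSpace]
  constructor
  · rintro ⟨g, hg, rfl⟩
    rwa [levelSum_self hg]
  · intro hf
    exact ⟨f, hf, levelSum_self hf⟩

theorem IsBinaryDecomposition.eq_levelSpace
    {H : (k : TypeIdx n) → RowIdx n k → Submodule 𝕜 (BinWord n → 𝕜)}
    (hH : IsBinaryDecomposition H) (k : TypeIdx n) (i : RowIdx n k) :
    H k i = levelSpace 𝕜 n k i := by
  have hk := k.2
  have hi := i.2
  exact Terwilliger.eq_levelSpace (by omega) (by omega) (hH.irreducible k i).1 (hH.supported k i)
    (hH.partition_type k i)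

end BlockMatrix

end Terwilliger

end

theorem mainTheorem2 (𝕜 : Type*) [RCLike 𝕜] (n : ℕ) :
    -- decompositions of the required kind exist
    (∃ H : (k : Terwilliger.TypeIdx n) → Terwilliger.RowIdx n k →
        Submodule 𝕜 (Terwilliger.BinWord n → 𝕜), Terwilliger.IsBinaryDecomposition H) ∧
    ∀ H : (k : Terwilliger.TypeIdx n) → Terwilliger.RowIdx n k →
        Submodule 𝕜 (Terwilliger.BinWord n → 𝕜), Terwilliger.IsBinaryDecomposition H →
      -- the dimensions
      (∀ (k : Terwilliger.TypeIdx n) (i : Terwilliger.RowIdx n k),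
        (Module.finrank 𝕜 (H k i) : ℝ) = Terwilliger.hdim n k) ∧
      ∀ (k : Terwilliger.TypeIdx n) (r : ℕ) (e : Fin r → H k (Terwilliger.firstRow k)),
        Terwilliger.IsOrthonormalBasis e →
        -- for suitable isometries the matrices are given exactly by the formula
        (∃ φ : (i : Terwilliger.RowIdx n k) → Terwilliger.GIsometry (Equiv.Perm (Fin n))
              (H k (Terwilliger.firstRow k)) (H k i),
          (φ (Terwilliger.firstRow k)).toEquiv = LinearEquiv.refl 𝕜 _ ∧
          (∀ i j : Terwilliger.RowIdx n k, (i : ℕ) ≤ j → ∀ x y : Terwilliger.BinWord n,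
            Terwilliger.weight x = i → Terwilliger.weight y = j →
            Terwilliger.blockMatrix e (φ i) (φ j) x y =
              ((Terwilliger.normConst n k i j *
                Terwilliger.hahnQ k (Terwilliger.vdiff x y) (n - j) j i : ℝ) : 𝕜)) ∧
          (∀ i j : Terwilliger.RowIdx n k, ∀ x y : Terwilliger.BinWord n,
            (Terwilliger.weight x ≠ i ∨ Terwilliger.weight y ≠ j) →
            Terwilliger.blockMatrix e (φ i) (φ j) x y = 0) ∧
          (∀ i j : Terwilliger.RowIdx n k,
            Terwilliger.blockMatrix e (φ j) (φ i) =
              (Terwilliger.blockMatrix e (φ i) (φ j)).transpose)) ∧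
        -- for all isometries they are given by the formula up to scalars of modulus one
        (∀ φ : (i : Terwilliger.RowIdx n k) → Terwilliger.GIsometry (Equiv.Perm (Fin n))
              (H k (Terwilliger.firstRow k)) (H k i),
          (∃ ε : Terwilliger.RowIdx n k → 𝕜, (∀ i, ‖ε i‖ = 1) ∧
            ∀ i j : Terwilliger.RowIdx n k, (i : ℕ) ≤ j → ∀ x y : Terwilliger.BinWord n,
              Terwilliger.weight x = i → Terwilliger.weight y = j →
              Terwilliger.blockMatrix e (φ i) (φ j) x y =
                ε i * (starRingEnd 𝕜) (ε j) *
                  ((Terwilliger.normConst n k i j *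
                    Terwilliger.hahnQ k (Terwilliger.vdiff x y) (n - j) j i : ℝ) : 𝕜)) ∧
          (∀ i j : Terwilliger.RowIdx n k, ∀ x y : Terwilliger.BinWord n,
            (Terwilliger.weight x ≠ i ∨ Terwilliger.weight y ≠ j) →
            Terwilliger.blockMatrix e (φ i) (φ j) x y = 0) ∧
          (∀ i j : Terwilliger.RowIdx n k,
            Terwilliger.blockMatrix e (φ j) (φ i) =
              (Terwilliger.blockMatrix e (φ i) (φ j)).conjTranspose)) := by
  refine ⟨⟨_, Terwilliger.isBinaryDecomposition_levelSpace⟩, fun H hH => ?_⟩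
  have hL := hH.eq_levelSpace
  have hH₁ : ∀ k : Terwilliger.TypeIdx n,
      H k (Terwilliger.firstRow k) = Terwilliger.harmonic 𝕜 n k := fun k =>
    (hL k _).trans (Terwilliger.levelSpace_self k)
  have hb : ∀ (k : Terwilliger.TypeIdx n) (i : Terwilliger.RowIdx n k),
      (k : ℕ) ≤ i ∧ (i : ℕ) + k ≤ n := fun k i => by
    have hk := k.2
    have hi := i.2
    omega
  refine ⟨fun k i => ?_, fun k r e he => ⟨?_, fun φ => ?_⟩⟩
  · obtain ⟨φ, -⟩ := Terwilliger.exists_gIsometry (hb k i).1 (hb k i).2 rfl (hL k i)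
    have hk := hb k (Terwilliger.firstRow k)
    rw [← φ.toEquiv.finrank_eq, Terwilliger.finrank_harmonic] <;> omega
  · choose φ hφ using fun i : Terwilliger.RowIdx n k =>
      Terwilliger.exists_gIsometry (hb k i).1 (hb k i).2 (hH₁ k) (hL k i)
    have hφ' : ∀ i f, ((φ i).toEquiv f : Terwilliger.BinWord n → 𝕜) =
        ((1 : 𝕜) * Terwilliger.levelFactor n k i) • Terwilliger.levelSum 𝕜 n i f := fun i f => by
      rw [one_mul, hφ]
    have h0 : ∀ i j : Terwilliger.RowIdx n k, ∀ x y : Terwilliger.BinWord n,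
        (Terwilliger.weight x ≠ i ∨ Terwilliger.weight y ≠ j) →
        Terwilliger.blockMatrix e (φ i) (φ j) x y = 0 := fun i j x y h =>
      Terwilliger.blockMatrix_eq_zero e _ _ (hH.supported k i) (hH.supported k j) h
    have hk := hb k (Terwilliger.firstRow k)
    refine ⟨φ, ?_, fun i j _ x y hx hy => ?_, h0, fun i j => ?_⟩
    -- At i = k the factor is 1 and `levelSum` fixes harmonic functions, so this choice satisfies
    -- φ_k = id.
    · refine LinearEquiv.ext fun f => Subtype.ext ?_
      have hf : (f : Terwilliger.BinWord n → 𝕜) ∈ Terwilliger.harmonic 𝕜 n k := hH₁ k ▸ f.2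
      rw [hφ, show ((Terwilliger.firstRow k : Terwilliger.RowIdx n k) : ℕ) = k from rfl,
        Terwilliger.levelFactor_self, Terwilliger.levelSum_self hf]
      simp
    · rw [Terwilliger.blockMatrix_eq (hb k i).1 (hb k i).2 (hb k j).1 (hb k j).2 (hH₁ k) he _ _
        (hφ' i) (hφ' j) hx hy]
      simp
    · ext x y
      rw [Matrix.transpose_apply]
      by_cases h : Terwilliger.weight x ≠ j ∨ Terwilliger.weight y ≠ i
      · rw [h0 j i x y h, h0 i j y x h.symm]
      · rw [not_or, not_ne_iff, not_ne_iff] at h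
        -- The scalars are real and the kernel is symmetric, so the plain transpose suffices here,
        -- even over ℂ.
        rw [Terwilliger.blockMatrix_eq_sum (by omega) (by omega) (hH₁ k) he _ _ (hφ j) (hφ i)
          h.1 h.2, Terwilliger.blockMatrix_eq_sum (by omega) (by omega) (hH₁ k) he _ _ (hφ i) (hφ j)
          h.2 h.1, RCLike.conj_ofReal, RCLike.conj_ofReal, Finset.sum_comm,
          mul_comm (Terwilliger.levelFactor n k j : 𝕜)]
        simp_rw [fun x' y' => Terwilliger.harmonicKernel_comm (𝕜 := 𝕜) (n := n) k x' y']
  · choose ε hε hφ using fun i : Terwilliger.RowIdx n k =>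
      Terwilliger.exists_norm_eq_one (hb k i).1 (hb k i).2 (hH₁ k) (hH.supported k i) (φ i)
    refine ⟨⟨ε, hε, fun i j _ x y hx hy => ?_⟩, fun i j x y h => ?_, fun i j => ?_⟩
    · exact Terwilliger.blockMatrix_eq (hb k i).1 (hb k i).2 (hb k j).1 (hb k j).2 (hH₁ k) he _ _
        (hφ i) (hφ j) hx hy
    · exact Terwilliger.blockMatrix_eq_zero e _ _ (hH.supported k i) (hH.supported k j) h
    · exact Terwilliger.blockMatrix_conjTranspose e _ _
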